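/- A deterministic weighted real-time one-counter automaton (DWROCA) over a finite alphabet $\Sigma$ and a field $F$ is a tuple $A=(Q,q_0,s_0,\delta_0,\delta_1,\eta)$, where $Q$ is a finite set of states, $q_0\in Q$ is the initial state, $s_0\in F$ is the initial weight, $\delta_0:Q\times\Sigma\to Q\times\{0,+1\}\times F$ and $\delta_1:Q\times\Sigma\to Q\times\{-1,0,+1\}\times F$ are the transition functions for zero and for positive counter values, and $\eta:Q\to F$ gives the output weights. A configuration is a triple $(q,n,s)\in Q\times\mathbb N\times F$ of a state, a counter value and an accumulated weight. On reading $a\in\Sigma$, the configuration $(q,n,s)$ moves to $(q',n+e,s\cdot t)$, where $(q',e,t)=\delta_0(q,a)$ if $n=0$ and $(q',e,t)=\delta_1(q,a)$ if $n>0$. For $w\in\Sigma^*$ put $f_A(w)=s\cdot\eta(q)$, where $(q,n,s)$ is the configuration reached from $(q_0,0,s_0)$ by reading $w$. Two DWROCAs $A$ and $B$ over the same $\Sigma$ and $F$ are equivalent if $f_A(w)=f_B(w)$ for all $w\in\Sigma^*$. Let $|A|$ denote the number of states of $A$. There is an absolute constant $C$ such that for every field $F$, every finite alphabet $\Sigma$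 and all DWROCAs $A$ and $B$ over $\Sigma$ and $F$, with $K=|A|+|B|$: if $A$ and $B$ are not equivalent, then there is a word $w\in\Sigma^*$ of length at most $C\cdot K^{26}$ (that is, of length $\mathcal O(K^{26})$) such that $f_A(w)\neq f_B(w)$. -/

import Mathlib

universe u v w₁ w₂

/-- A deterministic weighted real-time one-counter automaton (DWROCA) with set of states `Q`,
alphabet `α` and weights in `F`. A transition yields the next state, the change of the counter
and the weight of the transition. `δ₀` is used when the counter is zero, `δ₁` when it is
positive. -/
structure DWROCA (Q : Type*) (α : Type*) (F : Type*) where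
  /-- the initial state -/
  init : Q
  /-- the initial weight -/
  initWeight : F
  /-- the transitions for counter value zero -/
  δ₀ : Q → α → Q × ℤ × F
  /-- the transitions for positive counter values -/
  δ₁ : Q → α → Q × ℤ × F
  /-- the output weight of a state -/
  final : Q → F
  /-- a zero counter is kept or incremented -/
  δ₀_change : ∀ q a, (δ₀ q a).2.1 = 0 ∨ (δ₀ q a).2.1 = 1
  /-- a positive counter is decremented, kept or incremented -/
  δ₁_change : ∀ q a, (δ₁ q a).2.1 = -1 ∨ (δ₁ q a).2.1 = 0 ∨ (δ₁ q a).2.1 = 1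

namespace DWROCA

/-- A configuration: the state, the counter value and the weight accumulated so far. -/
structure Config (Q : Type*) (F : Type*) where
  /-- the current state -/
  state : Q
  /-- the current counter value -/
  counter : ℕ
  /-- the accumulated weight -/
  weight : F

variable {Q : Type*} {α : Type*} {F : Type*}

/-- The transition taken from state `q` with counter value `n` on the letter `a`. -/
def trans (A : DWROCA Q α F) (q : Q) (n : ℕ) (a : α) : Q × ℤ × F :=
  if n = 0 then A.δ₀ q a else A.δ₁ q a

/-- The counter never becomes negative, so that no truncation occurs in `step` below. -/
theorem counter_add_change_nonneg (A : DWROCA Q α F) (q : Q) (n : ℕ) (a : α) :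
    0 ≤ (n : ℤ) + (A.trans q n a).2.1 := by
  unfold trans
  split_ifs with h
  · have := A.δ₀_change q a
    omega
  · have := A.δ₁_change q a
    omega

/-- The successor of a configuration on a letter. -/
def step [Mul F] (A : DWROCA Q α F) (c : Config Q F) (a : α) : Config Q F where
  state := (A.trans c.state c.counter a).1
  counter := ((c.counter : ℤ) + (A.trans c.state c.counter a).2.1).toNat
  weight := c.weight * (A.trans c.state c.counter a).2.2

/-- The initial configuration, with counter value zero. -/
def initConfig (A : DWROCA Q α F) : Config Q F where
  state := A.init
  counter := 0
  weight := A.initWeight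

/-- The configuration reached from `c` by reading the word `w`. -/
def run [Mul F] (A : DWROCA Q α F) (c : Config Q F) (w : List α) : Config Q F :=
  w.foldl A.step c

/-- The value `f_A(w)` that the automaton assigns to the word `w`. -/
def value [Mul F] (A : DWROCA Q α F) (w : List α) : F :=
  (A.run A.initConfig w).weight * A.final (A.run A.initConfig w).state

/-- Two automata are equivalent if they assign the same value to every word. -/
def Equivalent {P : Type*} [Mul F] (A : DWROCA P α F) (B : DWROCA Q α F) : Prop :=
  ∀ w : List α, A.value w = B.value w

/-- The size of an automaton is its number of states. -/
def size [Fintype Q] (_A : DWROCA Q α F) : ℕ := Fintype.card Q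

end DWROCA

/-! Placing both automata side by side gives one automaton `M` with `K` states. The question then
concerns two of its configurations `c`, `d` with counter zero and a shortest word `w` that
distinguishes them (`MinimalWitness`). While the counter is positive, `M` acts as a finite
deterministic weighted automaton. Multiples of its behaviours that differ at all do so on a word
shorter than `depth = 2K²` (`posValue_separation`). A configuration is `Special` if, on words up to
that length, it does not behave like a multiple of one of these; its counter is then at most
`depth`. The distance `HasDist` to the special configurations can be read off from behaviours:
configurations with different distances are distinguished by a word not much longer than the
distance (`exists_ne_of_not_hasDist`).

From a high counter, some shortest path to a special configuration consists, up to short ends, of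
copies of one short cycle with the best ratio of length to loss (`HasDist.exists_cycle`). So the
distance is linear in the counter up to an error of order `K⁴`, and the counters `m`, `n` of two
configurations at equal distance satisfy `|X m - Y n| ≤ 22 K⁵` for some positive `X, Y ≤ K²`
(`exists_belt`). The pair `(m, n)` thus lies in one of few belts, and high up it cannot pass from
one direction to another (`belt_unique`).

Let `N` be the first time at which the two runs on `w` are not at equal finite distances. Before `N`
and high up, the runs stay in one belt, and levels with equal states and equal offset from the axis
of the belt allow both runs to be cut at once. Cutting changes weights, but the difference of the
two values is a form of rank two, so three such levels contradict minimality
(`false_of_triangular`). This excludes high excursions that return (`false_of_return`) and long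
climbs after which little of `w` remains (`false_of_climb`). What remains is a climb after which one
distance `δ` is the smaller one and exactly `δ + depth` letters follow (`MinimalWitness.tail`). Then
a shorter word reaches the same pair translated down along the belt. By minimality the translated
pair keeps equal distances while it reads the optimal cycle, so it keeps to the belt. Hence the
cycle moves exactly along the belt, and it carries the original pair to where the translated one
passes, which puts the second configuration within `δ` as well, a contradiction
(`false_of_translate`).

So the counter is `O(K¹⁴)` before `N`. Since no pair of states and counters occurs three times, `N`
is `O(K²⁵)`, and the rest of `w` is `O(K¹⁷)`. -/

namespace DWROCA

/-! ### Runs at positive counters and their translations -/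

section Runs

variable {S α F : Type*}

/-- The state reached from `p` by reading a word with the transitions for positive counters. -/
def posState (M : DWROCA S α F) : S → List α → S
  | p, [] => p
  | p, a :: u => M.posState (M.δ₁ p a).1 u

/-- The change of the counter when a word is read with the transitions for positive counters. -/
def drift (M : DWROCA S α F) : S → List α → ℤ
  | _, [] => 0
  | p, a :: u => (M.δ₁ p a).2.1 + M.drift (M.δ₁ p a).1 u

/-- The weight of a word that is read with the transitions for positive counters. -/
def posWeight [Field F] (M : DWROCA S α F) : S → List α → F
  | _, [] => 1
  | p, a :: u => (M.δ₁ p a).2.2 * M.posWeight (M.δ₁ p a).1 u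

/-- The value of a word from state `p` when the counter is never zero. -/
def posValue [Field F] (M : DWROCA S α F) (p : S) (w : List α) : F :=
  M.posWeight p w * M.final (M.posState p w)

/-- Reading `u` from state `p` and height `h` keeps the height positive. -/
def Above (M : DWROCA S α F) (p : S) (h : ℤ) (u : List α) : Prop :=
  ∀ x, x <+: u → 0 < h + M.drift p x

/-- The function on words computed from a configuration. -/
def behaviour [Field F] (M : DWROCA S α F) (c : Config S F) (w : List α) : F :=
  (M.run c w).weight * M.final (M.run c w).state

variable (M : DWROCA S α F)

@[simp] theorem posState_nil (p : S) : M.posState p [] = p := rfl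

@[simp] theorem drift_nil (p : S) : M.drift p [] = 0 := rfl

theorem _root_.List.prefix_append_or {x u v : List α} (h : x <+: u ++ v) :
    x <+: u ∨ ∃ t, x = u ++ t ∧ t <+: v := by
  rcases List.prefix_or_prefix_of_prefix h (List.prefix_append u v) with h1 | ⟨t, rfl⟩
  · exact Or.inl h1
  · exact Or.inr ⟨t, rfl, (List.prefix_append_right_inj u).1 h⟩

theorem posState_append (p : S) (u v : List α) :
    M.posState p (u ++ v) = M.posState (M.posState p u) v := by
  induction u generalizing p with
  | nil => rfl
  | cons a u ih => exact ih _

theorem drift_append (p : S) (u v : List α) :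
    M.drift p (u ++ v) = M.drift p u + M.drift (M.posState p u) v := by
  induction u generalizing p with
  | nil => simp
  | cons a u ih => simp only [List.cons_append, drift, posState, ih, add_assoc]

theorem abs_drift_le (p : S) (u : List α) : |M.drift p u| ≤ u.length := by
  induction u generalizing p with
  | nil => simp
  | cons a u ih =>
    have h1 := ih (M.δ₁ p a).1
    have h2 := M.δ₁_change p a
    simp only [drift, List.length_cons, abs_le] at *
    push_cast
    omega

theorem Above.pos {M : DWROCA S α F} {p : S} {h : ℤ} {u : List α} (hu : M.Above p h u) :
    0 < h := by
  have := hu [] (List.nil_prefix)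
  simpa using this

theorem above_append {p : S} {h : ℤ} {u v : List α} :
    M.Above p h (u ++ v) ↔ M.Above p h u ∧ M.Above (M.posState p u) (h + M.drift p u) v := by
  constructor
  · intro H
    refine ⟨fun x hx => H x (hx.trans (List.prefix_append _ _)), fun x hx => ?_⟩
    have := H (u ++ x) ((List.prefix_append_right_inj u).2 hx)
    rw [drift_append] at this
    linarith
  · rintro ⟨h1, h2⟩ x hx
    rcases List.prefix_append_or hx with hx | ⟨t, rfl, ht⟩
    · exact h1 x hx
    · have := h2 t ht
      rw [drift_append]
      linarith

theorem above_of_length_lt {p : S} {h : ℤ} {u : List α} (hu : (u.length : ℤ) < h) :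
    M.Above p h u := by
  intro x hx
  have h1 := hx.length_le
  have h2 := abs_le.1 (M.abs_drift_le p x)
  have : (x.length : ℤ) ≤ u.length := by exact_mod_cast h1
  linarith [h2.1]

variable [Field F]

@[simp] theorem posWeight_nil (p : S) : M.posWeight p [] = 1 := rfl

theorem posWeight_append (p : S) (u v : List α) :
    M.posWeight p (u ++ v) = M.posWeight p u * M.posWeight (M.posState p u) v := by
  induction u generalizing p with
  | nil => simp
  | cons a u ih => simp only [List.cons_append, posWeight, posState, ih, mul_assoc]

theorem posValue_append (p : S) (u v : List α) :
    M.posValue p (u ++ v) = M.posWeight p u * M.posValue (M.posState p u) v := by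
  simp only [posValue, posWeight_append, posState_append, mul_assoc]

@[simp] theorem run_nil (c : Config S F) : M.run c [] = c := rfl

theorem run_append (c : Config S F) (u v : List α) :
    M.run c (u ++ v) = M.run (M.run c u) v := by
  simp [run, List.foldl_append]

theorem run_cons (c : Config S F) (a : α) (u : List α) :
    M.run c (a :: u) = M.run (M.step c a) u := rfl

theorem behaviour_append (c : Config S F) (u v : List α) :
    M.behaviour c (u ++ v) = M.behaviour (M.run c u) v := by
  simp only [behaviour, run_append]

theorem run_scale (p : S) (m : ℕ) (s r : F) (u : List α) :
    M.run ⟨p, m, r * s⟩ u =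
      ⟨(M.run ⟨p, m, s⟩ u).state, (M.run ⟨p, m, s⟩ u).counter, r * (M.run ⟨p, m, s⟩ u).weight⟩ := by
  induction u generalizing p m s with
  | nil => rfl
  | cons a u ih =>
    simp only [run_cons, step, mul_assoc]
    exact ih _ _ _

theorem behaviour_scale (p : S) (m : ℕ) (s r : F) (u : List α) :
    M.behaviour ⟨p, m, r * s⟩ u = r * M.behaviour ⟨p, m, s⟩ u := by
  simp only [behaviour, run_scale, mul_assoc]

theorem behaviour_eq_mul (c : Config S F) (u : List α) :
    M.behaviour c u = c.weight * M.behaviour ⟨c.state, c.counter, 1⟩ u := by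
  rw [← behaviour_scale, mul_one]

theorem counter_step (c : Config S F) (a : α) :
    (M.step c a).counter ≤ c.counter + 1 ∧ c.counter ≤ (M.step c a).counter + 1 := by
  have h0 := M.δ₀_change c.state a
  have h1 := M.δ₁_change c.state a
  simp only [step, trans]
  split_ifs with h
  · omega
  · omega

theorem counter_run_le (c : Config S F) (u : List α) :
    (M.run c u).counter ≤ c.counter + u.length ∧ c.counter ≤ (M.run c u).counter + u.length := by
  induction u generalizing c with
  | nil => simp
  | cons a u ih =>
    have h1 := ih (M.step c a)
    have h2 := M.counter_step c a
    simp only [run_cons, List.length_cons]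
    omega

theorem run_eq_of_above {p : S} {m : ℕ} {s : F} {u : List α} (hu : M.Above p m u) :
    M.run ⟨p, m, s⟩ u =
      ⟨M.posState p u, (m + M.drift p u).toNat, s * M.posWeight p u⟩ := by
  induction u generalizing p m s with
  | nil => simp
  | cons a u ih =>
    have hm : 0 < (m : ℤ) := hu.pos
    have hm' : m ≠ 0 := by omega
    have h1 : M.Above (M.δ₁ p a).1 (m + (M.δ₁ p a).2.1) u := by
      intro x hx
      have := hu (a :: x) (by simpa using hx)
      simp only [drift] at this
      linarith
    have h2 := h1.pos
    have h3 : ((m : ℤ) + (M.δ₁ p a).2.1).toNat = (m : ℤ) + (M.δ₁ p a).2.1 :=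
      Int.toNat_of_nonneg h2.le
    rw [run_cons]
    simp only [step, trans, hm', if_false]
    rw [ih (by rw [h3]; exact h1)]
    simp only [posState, drift, posWeight, h3, mul_assoc, add_assoc]

/-- A run with positive counters is a run with the transitions for positive counters. -/
theorem above_of_run_pos {c : Config S F} {u : List α}
    (hu : ∀ x, x <+: u → 0 < (M.run c x).counter) : M.Above c.state c.counter u := by
  induction u generalizing c with
  | nil =>
    intro x hx
    obtain rfl := List.prefix_nil.1 hx
    have := hu [] List.nil_prefix
    simpa using this
  | cons a u ih =>
    have h0 : 0 < c.counter := by simpa using hu [] List.nil_prefix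
    have h1 := ih (c := M.step c a) (fun x hx => by
      have := hu (a :: x) (by simpa using hx)
      simpa [run_cons] using this)
    have hne : c.counter ≠ 0 := by omega
    have hc := M.δ₁_change c.state a
    simp only [step, trans, hne, if_false] at h1
    intro x hx
    cases x with
    | nil => simpa using h0
    | cons b x =>
      obtain ⟨rfl, hx'⟩ := List.cons_prefix_cons.1 hx
      have := h1 x hx'
      simp only [drift]
      omega

/-- The factor of `w` from position `i` to position `j`. -/
def factor (w : List α) (i j : ℕ) : List α := (w.take j).drop i

theorem take_append_factor (w : List α) {i j : ℕ} (h : i ≤ j) :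
    w.take i ++ factor w i j = w.take j := by
  conv_rhs => rw [← List.take_append_drop i (w.take j), List.take_take, min_eq_left h]
  rfl

theorem length_factor (w : List α) {i j : ℕ} (hj : j ≤ w.length) :
    (factor w i j).length = j - i := by
  simp [factor, min_eq_left hj]

theorem factor_append_factor (w : List α) {i j k : ℕ} (h : i ≤ j) (h' : j ≤ k) :
    factor w i j ++ factor w j k = factor w i k := by
  have h1 := take_append_factor w h
  have h2 := take_append_factor w h'
  have h3 := take_append_factor w (h.trans h')
  rw [← h2, ← h1, List.append_assoc] at h3
  exact (List.append_cancel_left h3).symm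

theorem prefix_factor {w x : List α} {i j : ℕ} (hj : j ≤ w.length) (hij : i ≤ j)
    (hx : x <+: factor w i j) :
    i + x.length ≤ j ∧ x = factor w i (i + x.length) := by
  have h1 := hx.length_le
  rw [length_factor w hj] at h1
  refine ⟨by omega, ?_⟩
  have h3 := factor_append_factor w (i := i) (j := i + x.length) (k := j) (by omega) (by omega)
  rw [← h3] at hx
  have hl := length_factor w (i := i) (j := i + x.length) (by omega)
  exact List.IsPrefix.eq_of_length
    (List.prefix_of_prefix_length_le hx (List.prefix_append _ _) (by omega)) (by omega)

theorem run_take_factor (c : Config S F) (w : List α) {i j : ℕ} (h : i ≤ j) :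
    M.run (M.run c (w.take i)) (factor w i j) = M.run c (w.take j) := by
  rw [← run_append, take_append_factor w h]

/-- A stretch of a run at heights above `d` may be translated down by `d`. -/
theorem above_factor {c : Config S F} {w : List α} {i j : ℕ} (hij : i ≤ j) (hj : j ≤ w.length)
    {d : ℤ} (hd : 0 ≤ d)
    (H : ∀ k, i ≤ k → k ≤ j → d < (M.run c (w.take k)).counter) :
    M.Above (M.run c (w.take i)).state ((M.run c (w.take i)).counter - d) (factor w i j) ∧
    ((M.run c (w.take j)).counter : ℤ) = (M.run c (w.take i)).counter +
      M.drift (M.run c (w.take i)).state (factor w i j) ∧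
    (M.run c (w.take j)).state = M.posState (M.run c (w.take i)).state (factor w i j) ∧
    (M.run c (w.take j)).weight = (M.run c (w.take i)).weight *
      M.posWeight (M.run c (w.take i)).state (factor w i j) := by
  have key : ∀ k, i ≤ k → k ≤ j →
      M.Above (M.run c (w.take i)).state (M.run c (w.take i)).counter (factor w i k) ∧
      M.run c (w.take k) = ⟨M.posState (M.run c (w.take i)).state (factor w i k),
        ((M.run c (w.take i)).counter + M.drift (M.run c (w.take i)).state (factor w i k)).toNat,
        (M.run c (w.take i)).weight * M.posWeight (M.run c (w.take i)).state (factor w i k)⟩ := by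
    intro k hk1 hk2
    have hA : M.Above (M.run c (w.take i)).state (M.run c (w.take i)).counter (factor w i k) := by
      apply above_of_run_pos
      intro x hx
      obtain ⟨h1, h2⟩ := prefix_factor (hk2.trans hj) hk1 hx
      rw [h2, run_take_factor M c w (by omega)]
      have := H (i + x.length) (by omega) (by omega)
      omega
    refine ⟨hA, ?_⟩
    rw [← run_take_factor M c w hk1, ← run_eq_of_above M hA]
  have hcount : ∀ k, i ≤ k → k ≤ j → ((M.run c (w.take k)).counter : ℤ) =
      (M.run c (w.take i)).counter + M.drift (M.run c (w.take i)).state (factor w i k) := by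
    intro k hk1 hk2
    obtain ⟨h1, h2⟩ := key k hk1 hk2
    have h3 := h1 (factor w i k) List.prefix_rfl
    rw [h2]
    exact Int.toNat_of_nonneg h3.le
  refine ⟨?_, hcount j hij le_rfl, ?_, ?_⟩
  · intro x hx
    obtain ⟨h1, h2⟩ := prefix_factor hj hij hx
    have h3 := hcount (i + x.length) (by omega) h1
    have h4 := H (i + x.length) (by omega) h1
    rw [← h2] at h3
    linarith
  · rw [(key j hij le_rfl).2]
  · rw [(key j hij le_rfl).2]

theorem posValue_cons (p : S) (a : α) (w : List α) :
    M.posValue p (a :: w) = (M.δ₁ p a).2.2 * M.posValue (M.δ₁ p a).1 w := by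
  simp only [posValue, posWeight, posState, mul_assoc]

theorem weight_run_eq_zero {c : Config S F} (h : c.weight = 0) (u : List α) :
    (M.run c u).weight = 0 := by
  have := M.run_scale c.state c.counter 0 0 u
  rw [zero_mul] at this
  rw [show c = ⟨c.state, c.counter, c.weight⟩ from rfl, h, this]
  simp

theorem counter_take_succ (c : Config S F) (w : List α) (i : ℕ) :
    (M.run c (w.take (i + 1))).counter ≤ (M.run c (w.take i)).counter + 1 ∧
    (M.run c (w.take i)).counter ≤ (M.run c (w.take (i + 1))).counter + 1 := by
  have h := M.counter_run_le (M.run c (w.take i)) (factor w i (i + 1))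
  rw [run_take_factor M c w (j := i + 1) (by omega)] at h
  have : (factor w i (i + 1)).length ≤ 1 := by
    simp only [factor, List.length_drop, List.length_take]
    omega
  omega

end Runs

/-! ### Level crossings and pigeonhole principles -/

section Levels

/-- The last time at which a sequence that climbs from below `x` to above `x` has value `x`. -/
theorem exists_last_eq {f : ℕ → ℕ} {a b x : ℕ} (hab : a ≤ b)
    (hf : ∀ i, a ≤ i → i < b → f (i + 1) ≤ f i + 1) (ha : f a ≤ x) (hb : x ≤ f b) :
    ∃ u, a ≤ u ∧ u ≤ b ∧ f u = x ∧ ∀ i, u < i → i ≤ b → x < f i := by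
  induction b, hab using Nat.le_induction with
  | base => exact ⟨a, le_rfl, le_rfl, by omega, fun i h1 h2 => by omega⟩
  | succ b hab ih =>
    rcases hb.eq_or_lt with h | h
    · exact ⟨b + 1, by omega, le_rfl, h.symm, fun i h1 h2 => by omega⟩
    · have h1 := hf b hab (by omega)
      obtain ⟨u, hu1, hu2, hu3, hu4⟩ := ih (fun i h1 h2 => hf i h1 (by omega)) (by omega)
      refine ⟨u, hu1, by omega, hu3, fun i hi1 hi2 => ?_⟩
      rcases Nat.le_succ_iff.1 hi2 with h2 | rfl
      · exact hu4 i hi1 h2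
      · exact h

/-- The first time at which a sequence that falls from above `x` to below `x` has value `x`. -/
theorem exists_first_eq {f : ℕ → ℕ} {a b x : ℕ} (hab : a ≤ b)
    (hf : ∀ i, a ≤ i → i < b → f i ≤ f (i + 1) + 1) (ha : x ≤ f a) (hb : f b ≤ x) :
    ∃ d, a ≤ d ∧ d ≤ b ∧ f d = x ∧ ∀ i, a ≤ i → i < d → x < f i := by
  induction b, hab using Nat.le_induction with
  | base => exact ⟨a, le_rfl, le_rfl, by omega, fun i h1 h2 => by omega⟩
  | succ b hab ih =>
    by_cases h : f b ≤ x
    · obtain ⟨d, h1, h2, h3, h4⟩ := ih (fun i h1 h2 => hf i h1 (by omega)) h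
      exact ⟨d, h1, by omega, h3, h4⟩
    -- The sequence may have dipped to `x` and risen again before `b`; the first dip is wanted.
    · by_cases hex : ∃ i, a ≤ i ∧ i ≤ b ∧ f i ≤ x
      · classical
        obtain ⟨h1, h2, h3⟩ := Nat.find_spec hex
        have h4 : ∀ i, a ≤ i → i < Nat.find hex → x < f i := fun i hi1 hi2 => by
          have := Nat.find_min hex hi2
          by_contra hc
          exact this ⟨hi1, by omega, by omega⟩
        refine ⟨Nat.find hex, h1, by omega, ?_, h4⟩
        rcases h1.eq_or_lt with h5 | h5
        · rw [← h5] at h3 ⊢; omega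
        · have h6 := h4 (Nat.find hex - 1) (by omega) (by omega)
          have h7 := hf (Nat.find hex - 1) (by omega) (by omega)
          rw [Nat.sub_add_cancel (by omega)] at h7
          omega
      · push Not at hex
        have h1 := hf b hab (by omega)
        refine ⟨b + 1, by omega, le_rfl, by omega, fun i hi1 hi2 => hex i hi1 (by omega)⟩

/-- Three numbers of an interval on which a function to a small set takes the same value. -/
theorem exists_three_eq {τ : Type*} (T : Finset τ) (f : ℕ → τ) {a b : ℕ}
    (hf : ∀ i, a ≤ i → i < b → f i ∈ T) (hT : a + 2 * T.card < b) :
    ∃ i j k, a ≤ i ∧ i < j ∧ j < k ∧ k < b ∧ f i = f j ∧ f j = f k := by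
  classical
  obtain ⟨y, -, hy⟩ := Finset.exists_lt_card_fiber_of_mul_lt_card_of_maps_to
    (s := Finset.Ico a b) (t := T) (f := f) (n := 2)
    (fun i hi => hf i (Finset.mem_Ico.1 hi).1 (Finset.mem_Ico.1 hi).2)
    (by rw [Nat.card_Ico]; omega)
  obtain ⟨i, j, k, hi, hj, hk, hij, hik, hjk⟩ := Finset.two_lt_card_iff.1 hy
  simp only [Finset.mem_filter, Finset.mem_Ico] at hi hj hk
  have key : ∀ i j k : ℕ, (a ≤ i ∧ i < b) ∧ f i = y → (a ≤ j ∧ j < b) ∧ f j = y →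
      (a ≤ k ∧ k < b) ∧ f k = y → i < j → j < k →
      ∃ i j k, a ≤ i ∧ i < j ∧ j < k ∧ k < b ∧ f i = f j ∧ f j = f k :=
    fun i j k hi hj hk h1 h2 => ⟨i, j, k, hi.1.1, h1, h2, hk.1.2, by rw [hi.2, hj.2],
      by rw [hj.2, hk.2]⟩
  rcases lt_or_gt_of_ne hij with h1 | h1 <;> rcases lt_or_gt_of_ne hjk with h2 | h2 <;>
    rcases lt_or_gt_of_ne hik with h3 | h3 <;> first
    | exact key _ _ _ hi hj hk h1 h2
    | exact key _ _ _ hi hk hj h3 h2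
    | exact key _ _ _ hj hi hk h1 h3
    | exact key _ _ _ hj hk hi h2 h3
    | exact key _ _ _ hk hi hj h3 h1
    | exact key _ _ _ hk hj hi h2 h1

theorem exists_two_eq {τ : Type*} (T : Finset τ) (f : ℕ → τ) {a b : ℕ}
    (hf : ∀ i, a ≤ i → i < b → f i ∈ T) (hT : a + T.card < b) :
    ∃ i j, a ≤ i ∧ i < j ∧ j < b ∧ f i = f j := by
  classical
  obtain ⟨i, hi, j, hj, hij, h⟩ := Finset.exists_ne_map_eq_of_card_lt_of_maps_to
    (s := Finset.Ico a b) (t := T) (f := f) (by rw [Nat.card_Ico]; omega)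
    (fun i hi => hf i (Finset.mem_Ico.1 hi).1 (Finset.mem_Ico.1 hi).2)
  rw [Finset.mem_Ico] at hi hj
  rcases lt_or_gt_of_ne hij with h1 | h1
  · exact ⟨i, j, hi.1, h1, hj.2, h⟩
  · exact ⟨j, i, hj.1, h1, hi.2, h.symm⟩

end Levels
end DWROCA

namespace DWROCA

/-! ### Special configurations and the distance to them -/

section Distance

variable {S α F : Type*} [Field F]

/-- Here `X`, `Y` stand for the values of a word without two loops, and the other letters for the
loop weights. If the values agree whenever a loop is missing, they agree with both loops present:
cancel `X`, or both sides vanish. -/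
theorem mul_eq_of_cuts {X Y μ ν μ' ν' : F} (h : X = Y) (h1 : X * μ = Y * ν)
    (h2 : X * μ' = Y * ν') : X * (μ * μ') = Y * (ν * ν') := by
  subst h
  by_cases hX : X = 0
  · simp [hX]
  · rw [mul_left_cancel₀ hX h1, mul_left_cancel₀ hX h2]

theorem exists_minimal_length {P : List α → Prop} (h : ∃ w, P w) :
    ∃ w, P w ∧ ∀ v, P v → w.length ≤ v.length := by
  classical
  have h' : ∃ n, ∃ w, P w ∧ w.length = n := by
    obtain ⟨w, hw⟩ := h
    exact ⟨_, w, hw, rfl⟩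
  obtain ⟨w, hw, hl⟩ := Nat.find_spec h'
  refine ⟨w, hw, fun v hv => ?_⟩
  rw [hl]
  exact Nat.find_min' h' ⟨v, hv, rfl⟩

theorem take_append_drop_factor (w : List α) {i j : ℕ} (h : i ≤ j) :
    w = w.take i ++ (factor w i j ++ w.drop j) := by
  rw [← List.append_assoc, take_append_factor w h, List.take_append_drop]

/-- On words of length at most `d`, the function `g` is a multiple of a positive behaviour. -/
def Approx (M : DWROCA S α F) (d : ℕ) (g : List α → F) : Prop :=
  ∃ r p, ∀ w : List α, w.length ≤ d → g w = r * M.posValue p w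

theorem Approx.smul {M : DWROCA S α F} {d : ℕ} {g : List α → F} (hg : M.Approx d g) (s : F) :
    M.Approx d fun w => s * g w := by
  obtain ⟨r, p, hp⟩ := hg
  exact ⟨s * r, p, fun w hw => by simp only [hp w hw, mul_assoc]⟩

/-- The word length up to which configurations are compared with the positive behaviours. -/
def depth (S : Type*) [Fintype S] : ℕ := 2 * Fintype.card S ^ 2

variable [Fintype S] (M : DWROCA S α F)

/-- A shortest separating word of length at least `2K²` passes three times through the same pair of
states. Without one or both of the loops in between it no longer separates, so by `mul_eq_of_cuts`
it does not separate at all. -/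
theorem posValue_separation {p q : S} {r r' : F}
    (h : ∃ w, r * M.posValue p w ≠ r' * M.posValue q w) :
    ∃ w, w.length < depth S ∧ r * M.posValue p w ≠ r' * M.posValue q w := by
  obtain ⟨w, hw, hmin⟩ := exists_minimal_length h
  refine ⟨w, ?_, hw⟩
  by_contra hlen
  push Not at hlen
  obtain ⟨i, j, k, -, hij, hjk, hk, e1, e2⟩ := exists_three_eq (a := 0) (b := w.length + 1)
    (Finset.univ : Finset (S × S))
    (fun i => (M.posState p (w.take i), M.posState q (w.take i))) (fun _ _ _ => Finset.mem_univ _)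
    (by rw [Finset.card_univ, Fintype.card_prod, ← sq]; unfold depth at hlen; omega)
  simp only [Prod.mk.injEq] at e1 e2
  set a := w.take i with ha
  set b := factor w i j with hb
  set b' := factor w j k with hb'
  set z := w.drop k with hz
  have hwj : w.take j = a ++ b := (take_append_factor w hij.le).symm
  have hwk : w.take k = a ++ b ++ b' := by rw [← hwj]; exact (take_append_factor w hjk.le).symm
  have hwz : w = a ++ b ++ b' ++ z := by rw [← hwk, hz, List.take_append_drop]
  have hlb : b.length = j - i := length_factor w (by omega)
  have hlb' : b'.length = k - j := length_factor w (by omega)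
  have hlw : w.length = a.length + b.length + b'.length + z.length := by
    conv_lhs => rw [hwz]
    simp only [List.length_append]
  rw [hwj, posState_append, posState_append] at e1
  rw [hwk, hwj, posState_append, posState_append, posState_append, posState_append] at e2
  rw [posState_append, posState_append] at e2
  rw [← e1.1, ← e1.2] at e2
  have short : ∀ v : List α, v.length < w.length →
      r * M.posValue p v = r' * M.posValue q v := fun v hv => by
    by_contra hc
    exact absurd (hmin v hc) (by omega)
  have h0 := short (a ++ z) (by rw [List.length_append]; omega)
  have h1 := short (a ++ (b ++ z)) (by simp only [List.length_append]; omega)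
  have h2 := short (a ++ (b' ++ z)) (by simp only [List.length_append]; omega)
  apply hw
  rw [hwz, List.append_assoc, List.append_assoc]
  simp only [posValue_append, ← e1.1, ← e1.2, ← e2.1, ← e2.2] at h0 h1 h2 ⊢
  have := mul_eq_of_cuts h0 (μ := M.posWeight (M.posState p a) b)
    (ν := M.posWeight (M.posState q a) b) (μ' := M.posWeight (M.posState p a) b')
    (ν' := M.posWeight (M.posState q a) b')
    (by linear_combination h1) (by linear_combination h2)
  linear_combination this

/-- The range grows letter by letter: the multiple that fits `g` and the one that fits `g (a :: ·)`
agree on words shorter than `depth`, hence on all words by `posValue_separation`. -/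
theorem approx_of_forall (j : ℕ) (g : List α → F)
    (hg : ∀ u : List α, u.length ≤ j → M.Approx (depth S) fun w => g (u ++ w)) :
    M.Approx (depth S + j) g := by
  induction j generalizing g with
  | zero => exact hg [] le_rfl
  | succ j ih =>
    obtain ⟨r, p, hp⟩ := ih g fun u hu => hg u (by omega)
    refine ⟨r, p, fun w hw => ?_⟩
    cases w with
    | nil => exact hp _ (Nat.zero_le _)
    | cons a w =>
      obtain ⟨r', p', hp'⟩ := ih (fun w => g (a :: w)) fun u hu => hg (a :: u) (by simpa using hu)
      rw [List.length_cons] at hw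
      beta_reduce at hp'
      rw [hp' w (by omega), posValue_cons, ← mul_assoc]
      by_contra hne
      obtain ⟨v, hv, hne'⟩ := M.posValue_separation ⟨w, hne⟩
      apply hne'
      rw [← hp' v (by omega), hp (a :: v) (by rw [List.length_cons]; omega), posValue_cons,
        mul_assoc]

theorem exists_short_of_approx {d : ℕ} {g g' : List α → F} (hd : depth S ≤ d)
    (hg : M.Approx d g) (hg' : M.Approx d g')
    (h : ∃ w : List α, w.length ≤ d ∧ g w ≠ g' w) :
    ∃ w : List α, w.length < depth S ∧ g w ≠ g' w := by
  obtain ⟨r, p, hp⟩ := hg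
  obtain ⟨r', p', hp'⟩ := hg'
  obtain ⟨w, hw, hne⟩ := h
  rw [hp w hw, hp' w hw] at hne
  obtain ⟨v, hv, hne'⟩ := M.posValue_separation ⟨w, hne⟩
  rw [← hp v (by omega), ← hp' v (by omega)] at hne'
  exact ⟨v, hv, hne'⟩

/-- The behaviour of the configuration differs on short words from the positive behaviours. -/
def Special (c : Config S F) : Prop :=
  ¬ M.Approx (depth S) (M.behaviour c)

theorem Special.weight_ne_zero {M : DWROCA S α F} {c : Config S F} (h : M.Special c) :
    c.weight ≠ 0 := by
  intro h0
  refine h ⟨0, c.state, fun w _ => ?_⟩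
  rw [behaviour_eq_mul, h0, zero_mul, zero_mul]

/-- From a larger counter, zero is out of reach for words of length `depth`, so the behaviour on
them is a positive one. -/
theorem Special.counter_le {M : DWROCA S α F} {c : Config S F} (h : M.Special c) :
    c.counter ≤ depth S := by
  by_contra hc
  push Not at hc
  refine h ⟨c.weight, c.state, fun w hw => ?_⟩
  have := M.run_eq_of_above (p := c.state) (m := c.counter) (s := c.weight)
    (M.above_of_length_lt (p := c.state) (h := c.counter) (u := w) (by exact_mod_cast (by omega)))
  unfold behaviour posValue
  rw [show c = ⟨c.state, c.counter, c.weight⟩ from rfl, this, mul_assoc]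

theorem Special.scale {M : DWROCA S α F} {p : S} {m : ℕ} {s s' : F} {u : List α}
    (h : M.Special (M.run ⟨p, m, s⟩ u)) (hs' : s' ≠ 0) : M.Special (M.run ⟨p, m, s'⟩ u) := by
  intro h'
  refine h ?_
  convert h'.smul (s * s'⁻¹) using 2 with w
  rw [← behaviour_append, ← behaviour_append, ← behaviour_scale, mul_assoc, inv_mul_cancel₀ hs',
    mul_one]

theorem Special.weight_ne_zero_of_run {M : DWROCA S α F} {c : Config S F} {u : List α}
    (h : M.Special (M.run c u)) : c.weight ≠ 0 := fun h0 =>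
  h.weight_ne_zero (M.weight_run_eq_zero h0 u)

/-- The length of a shortest word that leads to a special configuration is `δ`. -/
def HasDist (c : Config S F) (δ : ℕ) : Prop :=
  (∃ u : List α, u.length = δ ∧ M.Special (M.run c u)) ∧
    ∀ u : List α, M.Special (M.run c u) → δ ≤ u.length

variable {M}

theorem hasDist_of_special {c : Config S F} (h : ∃ u : List α, M.Special (M.run c u)) :
    ∃ δ, M.HasDist c δ := by
  obtain ⟨u, hu, hmin⟩ := exists_minimal_length h
  exact ⟨u.length, ⟨u, rfl, hu⟩, hmin⟩

theorem HasDist.unique {c : Config S F} {δ δ' : ℕ} (h : M.HasDist c δ) (h' : M.HasDist c δ') :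
    δ = δ' := by
  obtain ⟨⟨u, hu, hu'⟩, h2⟩ := h
  obtain ⟨⟨v, hv, hv'⟩, h4⟩ := h'
  have := h2 v hv'
  have := h4 u hu'
  omega

theorem HasDist.weight_ne_zero {c : Config S F} {δ : ℕ} (h : M.HasDist c δ) : c.weight ≠ 0 := by
  obtain ⟨⟨u, hu, hu'⟩, -⟩ := h
  exact hu'.weight_ne_zero_of_run

/-- The weight enters a behaviour only as a factor. Distances therefore depend on state and counter
alone, as long as weights do not vanish. -/
theorem HasDist.scale {p : S} {m : ℕ} {s s' : F} {δ : ℕ} (h : M.HasDist ⟨p, m, s⟩ δ)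
    (hs' : s' ≠ 0) : M.HasDist ⟨p, m, s'⟩ δ := by
  have hs := h.weight_ne_zero
  obtain ⟨⟨u, hu, hu'⟩, h2⟩ := h
  exact ⟨⟨u, hu, hu'.scale hs'⟩, fun v hv => h2 v (hv.scale hs)⟩

theorem HasDist.le_add {c : Config S F} {δ δ' : ℕ} (h : M.HasDist c δ) {u : List α}
    (h' : M.HasDist (M.run c u) δ') : δ ≤ u.length + δ' := by
  obtain ⟨⟨v, hv, hv'⟩, -⟩ := h'
  have := h.2 (u ++ v) (by rwa [run_append])
  rw [List.length_append] at this
  omega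

theorem HasDist.run {c : Config S F} {δ : ℕ} (h : M.HasDist c δ) {u v : List α}
    (huv : u.length + v.length = δ) (hs : M.Special (M.run c (u ++ v))) :
    M.HasDist (M.run c u) v.length := by
  refine ⟨⟨v, rfl, by rwa [← run_append]⟩, fun x hx => ?_⟩
  have := h.2 (u ++ x) (by rwa [run_append])
  rw [List.length_append] at this
  omega

/-- Some word of length at most `δ` leads to a special configuration on one side only. If the
behaviours agreed for `depth` more letters, the approximation on the other side would serve for
both. -/
theorem exists_ne_of_not_hasDist {c d : Config S F} {δ : ℕ} (h : M.HasDist c δ)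
    (h' : ¬ M.HasDist d δ) :
    ∃ v : List α, v.length ≤ δ + depth S ∧ M.behaviour c v ≠ M.behaviour d v := by
  have key : ∀ (c d : Config S F) (u : List α), u.length ≤ δ → M.Special (M.run c u) →
      ¬ M.Special (M.run d u) →
      ∃ v : List α, v.length ≤ δ + depth S ∧ M.behaviour c v ≠ M.behaviour d v := by
    intro c d u hu hc hd
    by_contra! hcon
    unfold Special at hd
    push Not at hd
    apply hc
    obtain ⟨r, p, hp⟩ := hd
    refine ⟨r, p, fun w hw => ?_⟩
    rw [← hp w hw, ← behaviour_append, ← behaviour_append]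
    exact hcon _ (by rw [List.length_append]; omega)
  by_cases hex : ∃ u : List α, u.length < δ ∧ M.Special (M.run d u)
  · obtain ⟨u, hu, hd⟩ := hex
    obtain ⟨v, hv, hne⟩ := key d c u hu.le hd fun hc => absurd (h.2 u hc) (by omega)
    exact ⟨v, hv, hne.symm⟩
  · push Not at hex
    obtain ⟨u, hu, hc⟩ := h.1
    refine key c d u hu.le hc fun hd => h' ⟨⟨u, hu, hd⟩, fun v hv => ?_⟩
    by_contra hlt
    exact hex v (by omega) hv

theorem approx_of_far {c : Config S F} {j : ℕ}
    (h : ∀ u : List α, M.Special (M.run c u) → j < u.length) :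
    M.Approx (depth S + j) (M.behaviour c) := by
  apply M.approx_of_forall
  intro u hu
  by_contra hc
  refine absurd (h u ?_) (by omega)
  unfold Special
  convert hc using 3 with w
  rw [behaviour_append]

end Distance
end DWROCA

namespace DWROCA

/-! ### A linear bound on the distance -/

section Reach

variable {S α F : Type*} [Field F] [Fintype S] {M : DWROCA S α F}

/-- A shortest path repeats no pair of state and counter, and it climbs at most `K²` above both its
start and `depth`. Otherwise two levels are crossed in the same states upwards and in the same
states downwards, and the part above the upper level can be read from the lower one. -/
theorem HasDist.le {c : Config S F} {δ : ℕ} (h : M.HasDist c δ) :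
    δ ≤ Fintype.card S * c.counter + 4 * Fintype.card S ^ 3 := by
  obtain ⟨⟨u, hu, hsp⟩, -⟩ := id h
  set K := Fintype.card S with hK
  have hKpos : 0 < K := Fintype.card_pos_iff.2 ⟨c.state⟩
  have hdist : ∀ i, i ≤ δ → M.HasDist (M.run c (u.take i)) (δ - i) := fun i hi => by
    have := h.run (u := u.take i) (v := u.drop i) (by simp; omega) (by simpa using hsp)
    rwa [List.length_drop, hu] at this
  have hrep : ∀ i j, i ≤ δ → j ≤ δ → (M.run c (u.take i)).state = (M.run c (u.take j)).state →
      (M.run c (u.take i)).counter = (M.run c (u.take j)).counter → i = j := by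
    intro i j hi hj h1 h2
    have h3 := hdist i hi
    have h4 := HasDist.scale (M := M) (p := (M.run c (u.take i)).state)
      (m := (M.run c (u.take i)).counter) h3 (hdist j hj).weight_ne_zero
    rw [h1, h2] at h4
    have := h4.unique (hdist j hj)
    omega
  set f : ℕ → ℕ := fun i => (M.run c (u.take i)).counter with hf
  set b := max c.counter (depth S) with hb
  have hbpos : 0 < b := lt_max_of_lt_right (by unfold depth; positivity)
  have hheight : ∀ i, i ≤ δ → f i ≤ b + K ^ 2 := by
    intro i hi
    by_contra hlt
    push Not at hlt
    have h0 : f 0 ≤ b := by simp [hf, hb]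
    have hend : f δ ≤ b := by
      have := hsp.counter_le
      simp only [hf, hb, ← hu, List.take_length]
      exact this.trans (le_max_right _ _)
    -- For each level: the last crossing before time `i` and the first one after it.
    have hlev : ∀ x, ∃ ud : ℕ × ℕ, b ≤ x → x < b + K ^ 2 + 1 →
        (ud.1 ≤ i ∧ f ud.1 = x ∧ ∀ k, ud.1 < k → k ≤ i → x < f k) ∧
        (i ≤ ud.2 ∧ ud.2 ≤ δ ∧ f ud.2 = x ∧ ∀ k, i ≤ k → k < ud.2 → x < f k) := by
      intro x
      by_cases hx : b ≤ x ∧ x < b + K ^ 2 + 1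
      · obtain ⟨a, -, h1, h2, h3⟩ := exists_last_eq (f := f) (x := x) (Nat.zero_le i)
          (fun k _ _ => (M.counter_take_succ c u k).1) (h0.trans hx.1) (by omega)
        obtain ⟨d, h4, h5, h6, h7⟩ := exists_first_eq (f := f) (x := x) hi
          (fun k _ _ => (M.counter_take_succ c u k).2) (by omega) (hend.trans hx.1)
        exact ⟨(a, d), fun _ _ => ⟨⟨h1, h2, h3⟩, h4, h5, h6, h7⟩⟩
      · exact ⟨(0, 0), fun h1 h2 => absurd ⟨h1, h2⟩ hx⟩
    choose ud hud using hlev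
    obtain ⟨x, y, hx, hxy, hy, he⟩ := exists_two_eq (a := b) (b := b + K ^ 2 + 1)
      (Finset.univ : Finset (S × S))
      (fun x => ((M.run c (u.take (ud x).1)).state, (M.run c (u.take (ud x).2)).state))
      (fun _ _ _ => Finset.mem_univ _)
      (by rw [Finset.card_univ, Fintype.card_prod, ← sq, ← hK]; omega)
    simp only [Prod.mk.injEq] at he
    obtain ⟨⟨a1, a2, a3⟩, a4, a5, a6, a7⟩ := hud x hx (by omega)
    obtain ⟨⟨b1, b2, b3⟩, b4, b5, b6, b7⟩ := hud y (by omega) hy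
    have hu12 : (ud x).1 < (ud y).1 := by
      by_contra hc
      rcases (not_lt.1 hc).eq_or_lt with h1 | h1
      · rw [h1] at b2; omega
      · have := b3 _ h1 a1; omega
    have hd12 : (ud y).2 < (ud x).2 := by
      by_contra hc
      rcases (not_lt.1 hc).eq_or_lt with h1 | h1
      · rw [h1] at a6; omega
      · have := b7 _ a4 h1; omega
    -- The stretch above level `y` is moved down by `y - x`. It then joins the two crossings of
    -- level `x`, up to a nonzero weight, in fewer letters.
    obtain ⟨hA, hcnt, hst, hwt⟩ := M.above_factor (c := c) (w := u) (i := (ud y).1)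
      (j := (ud y).2) (by omega) (by omega) (d := y - x) (by omega) (by
        intro k hk1 hk2
        have : y ≤ f k := by
          rcases hk1.eq_or_lt with h1 | h1
          · rw [← h1, b2]
          rcases hk2.eq_or_lt with h2 | h2
          · rw [h2, b6]
          rcases le_total k i with h3 | h3
          · exact (b3 k h1 h3).le
          · exact (b7 k h3 h2).le
        change _ < ((f k : ℕ) : ℤ)
        omega)
    simp only [hf] at a2 a6 b2 b6
    rw [b6, b2] at hcnt
    rw [b2, ← he.1, show (y : ℤ) - (y - x) = ((x : ℕ) : ℤ) by ring] at hA
    have hrun := M.run_eq_of_above (s := (M.run c (u.take (ud x).1)).weight) hA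
    rw [← he.1] at hcnt hst hwt
    have hw0 := (hdist (ud y).2 (by omega)).weight_ne_zero
    rw [hwt] at hw0
    have hw1 := (hdist (ud x).1 (by omega)).weight_ne_zero
    have hcfg : M.run c (u.take (ud x).1) =
        ⟨(M.run c (u.take (ud x).1)).state, x, (M.run c (u.take (ud x).1)).weight⟩ :=
      congrArg (fun m => Config.mk (M.run c (u.take (ud x).1)).state m
        (M.run c (u.take (ud x).1)).weight) a2
    rw [← hcfg, ← hst, ← he.2] at hrun
    have hz : ((x : ℤ) + M.drift (M.run c (u.take (ud x).1)).state
        (factor u (ud y).1 (ud y).2)).toNat = x := by omega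
    rw [hz] at hrun
    have h1 := hdist (ud x).1 (by omega)
    have h2 := hdist (ud x).2 (by omega)
    have h3 := HasDist.scale (M := M) (p := (M.run c (u.take (ud x).2)).state)
      (m := (M.run c (u.take (ud x).2)).counter) h2 (mul_ne_zero hw1 (right_ne_zero_of_mul hw0))
    rw [a6, ← hrun] at h3
    have h4 := h1.le_add h3
    rw [length_factor u (by omega)] at h4
    omega
  have hcard : δ + 1 ≤ K * (b + K ^ 2 + 1) := by
    by_contra hlt
    obtain ⟨i, j, -, hij, hj, he⟩ := exists_two_eq (a := 0) (b := δ + 1)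
      ((Finset.univ : Finset S) ×ˢ Finset.range (b + K ^ 2 + 1))
      (fun i => ((M.run c (u.take i)).state, f i))
      (fun i _ hi => by
        simp only [Finset.mem_product, Finset.mem_univ, Finset.mem_range, true_and]
        exact Nat.lt_succ_of_le (hheight i (by omega)))
      (by rw [Finset.card_product, Finset.card_univ, Finset.card_range, ← hK]; omega)
    simp only [Prod.mk.injEq] at he
    have := hrep i j (by omega) (by omega) he.1 he.2
    omega
  have hb2 : b ≤ c.counter + 2 * K ^ 2 := max_le (by omega) (by unfold depth; rw [← hK]; omega)
  have hK3 : K ≤ K ^ 3 := Nat.le_self_pow (by norm_num) K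
  calc δ ≤ K * (b + K ^ 2 + 1) := by omega
    _ ≤ K * (c.counter + 2 * K ^ 2 + K ^ 2 + 1) := by gcongr
    _ = K * c.counter + 3 * K ^ 3 + K := by ring
    _ ≤ _ := by omega

end Reach
end DWROCA

namespace DWROCA

/-! ### Repeating and removing cycles -/

section Cycles

variable {S α F : Type*}

/-- The word `u` repeated. -/
def wordPow (u : List α) : ℕ → List α
  | 0 => []
  | i + 1 => wordPow u i ++ u

theorem length_wordPow (u : List α) (i : ℕ) : (wordPow u i).length = i * u.length := by
  induction i with
  | zero => simp [wordPow]
  | succ i ih => rw [wordPow, List.length_append, ih]; ring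

theorem wordPow_add (u : List α) (i j : ℕ) : wordPow u (i + j) = wordPow u i ++ wordPow u j := by
  induction j with
  | zero => simp [wordPow]
  | succ j ih => rw [← add_assoc, wordPow, ih, wordPow, List.append_assoc]

variable (M : DWROCA S α F)

theorem posState_wordPow {v : S} {u : List α} (hv : M.posState v u = v) (i : ℕ) :
    M.posState v (wordPow u i) = v := by
  induction i with
  | zero => rfl
  | succ i ih => rw [wordPow, posState_append, ih, hv]

theorem drift_wordPow {v : S} {u : List α} (hv : M.posState v u = v) (i : ℕ) :
    M.drift v (wordPow u i) = i * M.drift v u := by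
  induction i with
  | zero => simp [wordPow]
  | succ i ih => rw [wordPow, drift_append, ih, M.posState_wordPow hv]; push_cast; ring

theorem posWeight_wordPow [Field F] {v : S} {u : List α} (hv : M.posState v u = v) (i : ℕ) :
    M.posWeight v (wordPow u i) = M.posWeight v u ^ i := by
  induction i with
  | zero => simp [wordPow]
  | succ i ih => rw [wordPow, posWeight_append, ih, M.posState_wordPow hv, pow_succ]

theorem above_wordPow {v : S} {u : List α} (hv : M.posState v u = v) {h : ℤ} (h0 : 0 < h) {i : ℕ}
    (H : ∀ t : ℕ, t < i → (u.length : ℤ) < h + t * M.drift v u) :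
    M.Above v h (wordPow u i) := by
  induction i with
  | zero =>
    intro x hx
    obtain rfl := List.prefix_nil.1 hx
    simpa using h0
  | succ i ih =>
    rw [wordPow, above_append]
    refine ⟨ih fun t ht => H t (by omega), ?_⟩
    rw [M.posState_wordPow hv, M.drift_wordPow hv]
    exact M.above_of_length_lt (H i (by omega))

variable [Field F] [Fintype S]

/-- Closed factors whose drift is divisible by `N` can be cut out of a word. -/
theorem exists_reduced {U : Set S} {ℓ b : ℤ} {N : ℕ} (hN : 0 < N)
    (hφ : ∀ v ∈ U, ∀ y : List α, y.length ≤ Fintype.card S * N →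
      (∀ x, x <+: y → M.posState v x ∈ U) → M.posState v y = v → M.posWeight v y ≠ 0 →
      (N : ℤ) ∣ M.drift v y → 0 ≤ b * y.length + ℓ * M.drift v y)
    (y : List α) (a : S) (hy : ∀ x, x <+: y → M.posState a x ∈ U) (hw : M.posWeight a y ≠ 0) :
    ∃ y' : List α, y'.length < Fintype.card S * N ∧ M.posState a y' = M.posState a y ∧
      M.posWeight a y' ≠ 0 ∧ (N : ℤ) ∣ M.drift a y' - M.drift a y ∧
      b * y'.length + ℓ * M.drift a y' ≤ b * y.length + ℓ * M.drift a y := by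
  induction hn : y.length using Nat.strong_induction_on generalizing y with
  | _ n ih =>
  subst hn
  by_cases hlen : y.length < Fintype.card S * N
  · exact ⟨y, hlen, rfl, hw, by simp, le_rfl⟩
  push Not at hlen
  -- Positions with the same state and the same drift modulo `N` enclose a closed factor whose drift
  -- is divisible by `N`.
  obtain ⟨i, j, -, hij, hj, he⟩ := exists_two_eq (a := 0) (b := Fintype.card S * N + 1)
    ((Finset.univ : Finset S) ×ˢ Finset.Ico (0 : ℤ) N)
    (fun i => (M.posState a (y.take i), M.drift a (y.take i) % N))
    (fun i _ _ => by
      simp only [Finset.mem_product, Finset.mem_univ, Finset.mem_Ico, true_and]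
      exact ⟨Int.emod_nonneg _ (by omega), Int.emod_lt_of_pos _ (by omega)⟩)
    (by rw [Finset.card_product, Finset.card_univ, Int.card_Ico]; simp)
  simp only [Prod.mk.injEq] at he
  obtain ⟨he1, he2⟩ := he
  have hy0 := take_append_drop_factor y hij.le
  have hyj := (take_append_factor y hij.le).symm
  have hli : (y.take i).length = i := by simp; omega
  have hlf : (factor y i j).length = j - i := length_factor y (by omega)
  set y1 := y.take i
  set y2 := factor y i j
  set y3 := y.drop j
  have hd : (N : ℤ) ∣ M.drift (M.posState a y1) y2 := by
    rw [hyj, drift_append] at he2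
    have := Int.ModEq.dvd he2
    rwa [add_sub_cancel_left] at this
  have hs : M.posState (M.posState a y1) y2 = M.posState a y1 := by
    rw [← posState_append, ← hyj, he1]
  have hw' := hw
  rw [hy0, posWeight_append, posWeight_append, hs] at hw'
  have hw1 := left_ne_zero_of_mul hw'
  have hw2 := left_ne_zero_of_mul (right_ne_zero_of_mul hw')
  have hw3 := right_ne_zero_of_mul (right_ne_zero_of_mul hw')
  -- Hence removing this factor does not raise the potential `b * length + ℓ * drift`.
  have hφ2 := hφ (M.posState a y1) (hy _ (by rw [hy0]; exact List.prefix_append _ _)) y2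
    (by rw [hlf]; omega) (fun x hx => by
      rw [← posState_append]
      refine hy _ ?_
      rw [hy0]
      exact (List.prefix_append_right_inj y1).2 (hx.trans (List.prefix_append _ _))) hs hw2 hd
  have hl : y.length = y1.length + (y2.length + y3.length) := by
    conv_lhs => rw [hy0]
    simp only [List.length_append]
  obtain ⟨y', h1, h2, h3, h4, h5⟩ := ih (y1 ++ y3).length
    (by rw [List.length_append]; omega) (y1 ++ y3)
    (by
      intro x hx
      rcases List.prefix_append_or hx with hx | ⟨t, rfl, ht⟩
      · exact hy x (hx.trans (by conv_rhs => rw [hy0]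
                                 exact List.prefix_append _ _))
      · have h := hy (y1 ++ (y2 ++ t)) (by
          conv_rhs => rw [hy0]
          exact (List.prefix_append_right_inj y1).2 ((List.prefix_append_right_inj y2).2 ht))
        rw [posState_append, posState_append, hs] at h
        rwa [posState_append])
    (by rw [posWeight_append]; exact mul_ne_zero hw1 hw3) rfl
  have hst : M.posState a y = M.posState a (y1 ++ y3) := by
    conv_lhs => rw [hy0]
    rw [posState_append, posState_append, hs, posState_append]
  have hdr : M.drift a y = M.drift a (y1 ++ y3) + M.drift (M.posState a y1) y2 := by
    conv_lhs => rw [hy0]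
    rw [drift_append, drift_append, hs, drift_append]
    ring
  refine ⟨y', h1, by rw [h2, hst], h3, ?_, ?_⟩
  · rw [hdr]
    rw [← sub_sub]
    exact dvd_sub h4 hd
  · rw [hdr, hl]
    refine h5.trans ?_
    rw [List.length_append]
    push_cast
    linarith

end Cycles
end DWROCA

namespace DWROCA

/-! ### Best cycles, slopes and belts -/

section Slopes

variable {S α F : Type*} [Field F] [Fintype S] (M : DWROCA S α F)

/-- If a word loses much height, then among the short cycles at its states there is one with the
least ratio of length to loss, and no closed word has a smaller ratio. -/
theorem exists_best_cycle {p : S} {y : List α} (hw : M.posWeight p y ≠ 0)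
    (hd : M.drift p y ≤ -Fintype.card S) :
    ∃ (x z C : List α) (b : ℕ), y = x ++ z ∧ 1 ≤ C.length ∧ C.length ≤ Fintype.card S ∧ 1 ≤ b ∧
      b ≤ Fintype.card S ∧ M.posState (M.posState p x) C = M.posState p x ∧
      M.posWeight (M.posState p x) C ≠ 0 ∧ M.drift (M.posState p x) C = -b ∧
      ∀ v ∈ {v | ∃ t, t <+: y ∧ M.posState p t = v}, ∀ t : List α,
        (∀ t', t' <+: t → M.posState v t' ∈ {v | ∃ t, t <+: y ∧ M.posState p t = v}) →
        M.posState v t = v → M.posWeight v t ≠ 0 →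
        0 ≤ (b : ℤ) * t.length + (C.length : ℤ) * M.drift v t := by
  classical
  set K := Fintype.card S with hK
  set U : Set S := {v | ∃ t, t <+: y ∧ M.posState p t = v} with hU
  have hpU : ∀ x, x <+: y → M.posState p x ∈ U := fun x hx => ⟨x, hx, rfl⟩
  -- Pairs of length and loss realised by closed words at states visited by `y`; the finite set `T`
  -- below collects the short ones.
  let Q : ℕ × ℕ → Prop := fun e => ∃ v ∈ U, ∃ t : List α, t.length = e.1 ∧ M.posState v t = v ∧
    M.posWeight v t ≠ 0 ∧ M.drift v t = -e.2
  set T := ((Finset.Icc 1 K ×ˢ Finset.Icc 1 K).filter Q) with hT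
  have hcand : ∀ v ∈ U, ∀ t : List α, t.length ≤ K → M.posState v t = v → M.posWeight v t ≠ 0 →
      M.drift v t < 0 → (t.length, (-M.drift v t).toNat) ∈ T := by
    intro v hv t ht h1 h2 h3
    have h4 := abs_le.1 (M.abs_drift_le v t)
    simp only [hT, Finset.mem_filter, Finset.mem_product, Finset.mem_Icc]
    refine ⟨⟨⟨by omega, ht⟩, by omega, by omega⟩, v, hv, t, rfl, h1, h2, by simp; omega⟩
  -- With `ℓ = 1` and `b = 0` the potential is the drift itself. Without a losing cycle, reduction
  -- would leave a word shorter than `K` that loses at least `K`.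
  have hne : T.Nonempty := by
    by_contra hemp
    rw [Finset.not_nonempty_iff_eq_empty] at hemp
    obtain ⟨y', h1, -, -, -, h5⟩ := M.exists_reduced (U := U) (ℓ := 1) (b := 0) (N := 1) one_pos
      (fun v hv t ht _ h1 h2 _ => by
        by_contra hneg
        have := hcand v hv t (by omega) h1 h2 (by linarith)
        rw [hemp] at this
        simp at this) y p hpU hw
    have h6 := abs_le.1 (M.abs_drift_le p y')
    have h7 : (y'.length : ℤ) < K := by exact_mod_cast (by omega)
    linarith [h6.1]
  obtain ⟨⟨ℓ, b⟩, hmem, hmin⟩ := T.exists_min_image (fun e => (e.1 : ℚ) / e.2) hne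
  simp only [hT, Finset.mem_filter, Finset.mem_product, Finset.mem_Icc] at hmem
  obtain ⟨⟨⟨hℓ1, hℓ2⟩, hb1, hb2⟩, v, ⟨x, ⟨z, hz⟩, hxv⟩, C, hC1, hC2, hC3, hC4⟩ := hmem
  have hshort : ∀ v ∈ U, ∀ t : List α, t.length ≤ K → M.posState v t = v →
      M.posWeight v t ≠ 0 → 0 ≤ (b : ℤ) * t.length + (ℓ : ℤ) * M.drift v t := by
    intro v hv t ht h1 h2
    rcases lt_or_ge (M.drift v t) 0 with h3 | h3
    · have h4 := hmin _ (hcand v hv t ht h1 h2 h3)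
      obtain ⟨n, hn⟩ : ∃ n : ℕ, M.drift v t = -n := ⟨(-M.drift v t).toNat, by omega⟩
      have hn1 : 0 < n := by omega
      rw [hn] at h4 ⊢
      simp only [neg_neg, Int.toNat_natCast] at h4
      rw [div_le_div_iff₀ (by exact_mod_cast hb1) (by exact_mod_cast hn1)] at h4
      have h5 : ℓ * n ≤ t.length * b := by exact_mod_cast h4
      have h6 : (ℓ : ℤ) * n ≤ t.length * b := by exact_mod_cast h5
      linarith
    · positivity
  subst hxv
  refine ⟨x, z, C, b, hz.symm, by omega, by omega, hb1, hb2, hC2, hC3, hC4, ?_⟩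
  intro v hv t ht h1 h2
  -- Long closed words reduce to short ones without raising the potential, so the optimal ratio
  -- bounds them too.
  obtain ⟨t', h3, h4, h5, -, h7⟩ := M.exists_reduced (U := U) (ℓ := ℓ) (b := b) (N := 1) one_pos
    (fun v hv t ht _ h1 h2 _ => hshort v hv t (by omega) h1 h2) t v ht h2
  have := hshort v hv t' (by omega) (h4.trans h1) h5
  have hC1' : C.length = ℓ := hC1
  rw [hC1']
  linarith

variable {M}

set_option maxHeartbeats 1000000 in
/-- A configuration with a large counter has a shortest path that repeats a short cycle. -/
theorem HasDist.exists_cycle {p : S} {m : ℕ} {s : F} {δ : ℕ} (h : M.HasDist ⟨p, m, s⟩ δ)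
    (hm : 6 * Fintype.card S ^ 2 ≤ m) :
    ∃ (x C : List α) (b J : ℕ), x.length ≤ Fintype.card S ^ 2 ∧ 1 ≤ C.length ∧
      C.length ≤ Fintype.card S ∧ 1 ≤ b ∧ b ≤ Fintype.card S ∧
      M.posState (M.posState p x) C = M.posState p x ∧ M.posWeight p x ≠ 0 ∧
      M.posWeight (M.posState p x) C ≠ 0 ∧ M.drift (M.posState p x) C = -b ∧
      3 * (Fintype.card S : ℤ) ^ 2 ≤ m + M.drift p x - J * b ∧
      m + M.drift p x - J * b ≤ 5 * (Fintype.card S : ℤ) ^ 2 ∧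
      ∀ i ≤ J, ∃ n δ' : ℕ, (n : ℤ) = m + M.drift p x - i * b ∧
        M.HasDist ⟨M.posState p x, n, 1⟩ δ' ∧ δ = x.length + i * C.length + δ' := by
  obtain ⟨⟨u, hu, hsp⟩, -⟩ := id h
  have hs := h.weight_ne_zero
  set c : Config S F := ⟨p, m, s⟩ with hc
  set K := Fintype.card S with hK
  have hKpos : 0 < K := Fintype.card_pos_iff.2 ⟨p⟩
  have hK1 : K ≤ K ^ 2 := Nat.le_self_pow two_ne_zero K
  set f : ℕ → ℕ := fun i => (M.run c (u.take i)).counter with hf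
  have hend : f u.length ≤ 4 * K ^ 2 := by
    have := hsp.counter_le
    simp only [hf, List.take_length]
    refine this.trans ?_
    unfold depth
    rw [← hK]
    omega
  -- The level `4K²` lies above all special counters, and words of length `K²` read near it keep the
  -- height positive.
  obtain ⟨e, -, he2, he3, he4⟩ := exists_first_eq (f := f) (x := 4 * K ^ 2)
    (Nat.zero_le u.length) (fun k _ _ => (M.counter_take_succ c u k).2)
    (by simp only [hf, List.take_zero, run_nil, hc]; omega) hend
  obtain ⟨hA, hcnt, hst, hwt⟩ := M.above_factor (c := c) (w := u) (i := 0) (j := e)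
    (Nat.zero_le _) he2 (d := 0) le_rfl (by
      intro k _ hk
      have : 0 < f k := by
        rcases hk.eq_or_lt with h1 | h1
        · rw [h1, he3]; positivity
        · exact (Nat.zero_le _).trans_lt (he4 k (Nat.zero_le _) h1)
      exact_mod_cast this)
  have hfac : factor u 0 e = u.take e := rfl
  simp only [hfac, List.take_zero, run_nil, sub_zero] at hA hcnt hst hwt
  set y := u.take e with hy
  have hyl : y.length = e := by simp [hy]; omega
  have he3' : (M.run c y).counter = 4 * K ^ 2 := he3
  rw [he3'] at hcnt
  simp only [hc] at hcnt hwt hst hA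
  push_cast at hcnt
  have huy : u = y ++ u.drop e := (List.take_append_drop e u).symm
  have hdist : M.HasDist (M.run c y) (δ - e) := by
    have := h.run (u := y) (v := u.drop e) (by simp [hyl]; omega) (by rwa [← huy])
    rwa [List.length_drop, hu] at this
  have hwy : M.posWeight p y ≠ 0 := by
    have := hdist.weight_ne_zero
    rw [hwt] at this
    exact right_ne_zero_of_mul this
  have hK2 : (K : ℤ) ≤ K ^ 2 := by exact_mod_cast hK1
  have hm' : 6 * (K : ℤ) ^ 2 ≤ m := by exact_mod_cast hm
  obtain ⟨x, z, C, b, hxz, hC1, hC2, hb1, hb2, hC3, hC4, hC5, hclosed⟩ :=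
    M.exists_best_cycle hwy (by rw [← hK]; linarith)
  set v := M.posState p x with hv
  have hKb : K * b ≤ K ^ 2 := by rw [sq]; exact Nat.mul_le_mul_left _ hb2
  have hφ := fun (v : S) hv (t : List α) (_ : t.length ≤ K * b) h1 h2 h3
    (_ : (b : ℤ) ∣ M.drift v t) => hclosed v hv t h1 h2 h3
  have hxw : M.posWeight p x ≠ 0 ∧ M.posWeight v z ≠ 0 := by
    rw [hxz, posWeight_append] at hwy
    exact ⟨left_ne_zero_of_mul hwy, right_ne_zero_of_mul hwy⟩
  -- On either side of the state of `C`, factors with drift divisible by `b` are removed. The total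
  -- change of drift is then made up by copies of `C`.
  obtain ⟨x', hx1, hx2, hx3, hx4, hx5⟩ := M.exists_reduced (by omega : 0 < b) hφ x p
    (fun t ht => ⟨t, ht.trans (by rw [hxz]; exact List.prefix_append _ _), rfl⟩) hxw.1
  obtain ⟨z', hz1, hz2, hz3, hz4, hz5⟩ := M.exists_reduced (by omega : 0 < b) hφ z v
    (fun t ht => ⟨x ++ t, by rw [hxz]; exact (List.prefix_append_right_inj x).2 ht,
      by rw [posState_append]⟩) hxw.2
  have hdy : M.drift p y = M.drift p x + M.drift v z := by rw [hxz, drift_append]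
  have hyz : M.posState p y = M.posState v z := by rw [hxz, posState_append]
  obtain ⟨J', hJ'⟩ := dvd_add hx4 hz4
  rw [← hK] at hx1 hz1
  have hx6 := abs_le.1 (M.abs_drift_le p x')
  have hz6 := abs_le.1 (M.abs_drift_le v z')
  have hx7 : (x'.length : ℤ) ≤ K ^ 2 := by exact_mod_cast (by omega)
  have hz7 : (z'.length : ℤ) ≤ K ^ 2 := by exact_mod_cast (by omega)
  have hb1' : (1 : ℤ) ≤ b := by exact_mod_cast hb1
  -- The word `y` loses at least `2K²`, while `x'` and `z'` together lose at most that.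
  have hJ0 : 0 ≤ J' := by
    by_contra hneg
    have : (b : ℤ) * J' < 0 := mul_neg_of_pos_of_neg (by linarith) (by linarith)
    linarith
  obtain ⟨J, rfl⟩ := Int.eq_ofNat_of_zero_le hJ0
  rw [← hv] at hx2
  have hC3' : M.posState (M.posState p x') C = M.posState p x' := by rw [hx2, hC3]
  set n := x' ++ (wordPow C J ++ z') with hn
  have hKz : (K : ℤ) ^ 2 ≤ 3 * K ^ 2 := by linarith [sq_nonneg (K : ℤ)]
  have hKK : (0 : ℤ) < K ^ 2 := by positivity
  have hend' : (m : ℤ) + M.drift p x' - J * b = 4 * K ^ 2 - M.drift v z' := by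
    linarith [mul_comm (J : ℤ) b]
  have hAn : M.Above p m n := by
    rw [hn, above_append, above_append, hx2, M.posState_wordPow hC3, M.drift_wordPow hC3, hC5]
    refine ⟨M.above_of_length_lt (by linarith), M.above_wordPow hC3 (by linarith) ?_,
      M.above_of_length_lt (by linarith)⟩
    intro t ht
    have h1 : (t : ℤ) * b ≤ J * b := mul_le_mul_of_nonneg_right (by exact_mod_cast ht.le)
      (by linarith)
    have h2 : (C.length : ℤ) ≤ K := by exact_mod_cast hC2
    rw [hC5]
    linarith
  have hndrift : M.drift p n = M.drift p y := by
    rw [hn, drift_append, drift_append, hx2, M.posState_wordPow hC3, M.drift_wordPow hC3, hC5]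
    linarith [mul_comm (J : ℤ) b]
  have hnstate : M.posState p n = M.posState p y := by
    rw [hn, posState_append, posState_append, hx2, M.posState_wordPow hC3, hz2, hyz]
  have hnweight : M.posWeight p n ≠ 0 := by
    rw [hn, posWeight_append, posWeight_append, hx2, M.posState_wordPow hC3,
      M.posWeight_wordPow hC3]
    exact mul_ne_zero hx3 (mul_ne_zero (pow_ne_zero _ hC4) hz3)
  have hnrun := M.run_eq_of_above (s := s) hAn
  have hyrun := M.run_eq_of_above (s := s) hA
  rw [hndrift, hnstate] at hnrun
  rw [← hc] at hnrun hyrun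
  have hndist : M.HasDist (M.run c n) (δ - e) := by
    rw [hnrun]
    rw [hyrun] at hdist
    exact hdist.scale (mul_ne_zero hs hnweight)
  have hnlen1 := h.le_add hndist
  have hnl : n.length = x'.length + (J * C.length + z'.length) := by
    rw [hn, List.length_append, List.length_append, length_wordPow]
  -- The potential of `C` is zero, reduction does not raise it, and `n` has the drift of `y`; so `n`
  -- is no longer than `y`.
  have hnlen2 : n.length ≤ e := by
    have h1 : (e : ℤ) = x.length + z.length := by
      rw [← hyl, hxz, List.length_append]; push_cast; ring
    have h2 : (b : ℤ) * n.length ≤ b * e := by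
      rw [hnl, h1]
      push_cast
      have : (C.length : ℤ) * (M.drift p x' - M.drift p x + (M.drift v z' - M.drift v z)) =
        C.length * (b * J) := by rw [hJ']
      linarith
    exact_mod_cast le_of_mul_le_mul_left h2 (by linarith)
  -- Since `y` begins a shortest path, so does `n`, and the distances along it are known exactly.
  have hne : n.length = e := by omega
  obtain ⟨⟨t, ht1, ht2⟩, -⟩ := hndist
  refine ⟨x', C, b, J, by omega, hC1, hC2, hb1, hb2, hC3', hx3, by rwa [hx2], by rw [hx2, hC5],
    by linarith, by linarith, ?_⟩
  intro i hi
  have hsplit' : n = (x' ++ wordPow C i) ++ (wordPow C (J - i) ++ z') := by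
    rw [hn, show wordPow C J = wordPow C (i + (J - i)) by rw [Nat.add_sub_cancel' hi],
      wordPow_add]
    simp only [List.append_assoc]
  have hsplit : n ++ t = (x' ++ wordPow C i) ++ (wordPow C (J - i) ++ (z' ++ t)) := by
    rw [hsplit']
    simp only [List.append_assoc]
  have hlen : (x' ++ wordPow C i).length = x'.length + i * C.length := by
    rw [List.length_append, length_wordPow]
  have htot : (x' ++ wordPow C i).length + (wordPow C (J - i) ++ (z' ++ t)).length = δ := by
    rw [← List.length_append, ← hsplit, List.length_append]; omega
  have hdi := h.run htot (by rwa [← hsplit, run_append])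
  have hAi : M.Above p m (x' ++ wordPow C i) := fun y hy => hAn y (hy.trans (by
    rw [hsplit']
    exact List.prefix_append _ _))
  rw [hc, M.run_eq_of_above hAi, posState_append, drift_append, hx2, M.posState_wordPow hC3,
    M.drift_wordPow hC3, hC5] at hdi
  have hpos := hAi _ List.prefix_rfl
  rw [drift_append, hx2, M.drift_wordPow hC3, hC5] at hpos
  refine ⟨((m : ℤ) + (M.drift p x' + i * -b)).toNat, (wordPow C (J - i) ++ (z' ++ t)).length,
    ?_, ?_, ?_⟩
  · rw [Int.toNat_of_nonneg hpos.le]; ring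
  · rw [hx2]; exact hdi.scale one_ne_zero
  · omega

/-- Each round of the cycle from `HasDist.exists_cycle` takes `ℓ` from the distance and `b` from the
counter. After the last round the counter is at most `5K²`, and `HasDist.le` bounds the remaining
distance by `9K³`. For counters below `6K²` any slope will do. -/
theorem HasDist.exists_slope {c : Config S F} {δ : ℕ} (h : M.HasDist c δ) :
    ∃ ℓ b : ℕ, 1 ≤ ℓ ∧ ℓ ≤ Fintype.card S ∧ 1 ≤ b ∧ b ≤ Fintype.card S ∧
      |(b : ℤ) * δ - ℓ * c.counter| ≤ 11 * (Fintype.card S : ℤ) ^ 4 := by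
  obtain ⟨p, m, s⟩ := c
  set K := Fintype.card S with hK
  have hKpos : 0 < K := Fintype.card_pos_iff.2 ⟨p⟩
  have hK1 : (1 : ℤ) ≤ K := by exact_mod_cast hKpos
  have h34 : (K : ℤ) ^ 3 ≤ K ^ 4 := pow_le_pow_right₀ hK1 (by norm_num)
  have h23 : (K : ℤ) ^ 2 ≤ K ^ 3 := pow_le_pow_right₀ hK1 (by norm_num)
  have h0 : (0 : ℤ) < K ^ 2 := by positivity
  rcases lt_or_ge m (6 * K ^ 2) with hm | hm
  · refine ⟨1, 1, le_rfl, hKpos, le_rfl, hKpos, ?_⟩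
    have h1 := h.le
    rw [← hK] at h1
    simp only at h1 ⊢
    have h2 : (δ : ℤ) ≤ K * m + 4 * K ^ 3 := by exact_mod_cast h1
    have h3 : (m : ℤ) ≤ 6 * K ^ 2 := by exact_mod_cast hm.le
    have h4 : (K : ℤ) * m ≤ 6 * K ^ 3 := by nlinarith
    rw [abs_le]
    constructor
    · push_cast; linarith
    · push_cast; linarith
  · obtain ⟨x, C, b, J, hx, hC1, hC2, hb1, hb2, -, -, -, -, hJ1, hJ2, hJ3⟩ := h.exists_cycle hm
    refine ⟨C.length, b, hC1, hC2, hb1, hb2, ?_⟩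
    rw [← hK] at hx hC2 hb2 hJ1 hJ2
    obtain ⟨n, δ', hn, hδ', hδ⟩ := hJ3 J le_rfl
    have h1 := hδ'.le
    rw [← hK] at h1
    simp only at h1 ⊢
    have h1' : (δ' : ℤ) ≤ K * n + 4 * K ^ 3 := by exact_mod_cast h1
    rw [← hn] at hJ1 hJ2
    have h2 : (K : ℤ) * n ≤ 5 * K ^ 3 := by nlinarith
    have h3 := abs_le.1 (M.abs_drift_le p x)
    have hxz : (x.length : ℤ) ≤ K ^ 2 := by exact_mod_cast hx
    have hC2' : (C.length : ℤ) ≤ K := by exact_mod_cast hC2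
    have hb2' : (b : ℤ) ≤ K := by exact_mod_cast hb2
    have hm2 : (m : ℤ) = n - M.drift p x + J * b := by linarith
    have hδz : (δ : ℤ) = x.length + J * C.length + δ' := by exact_mod_cast hδ
    have e : (b : ℤ) * δ - C.length * m =
        b * x.length + b * δ' - C.length * n + C.length * M.drift p x := by
      rw [hδz, hm2]; ring
    rw [e]
    have i1 : (b : ℤ) * x.length ≤ K * K ^ 2 := by gcongr
    have i2 : (b : ℤ) * δ' ≤ K * (9 * K ^ 3) := by
      have : (δ' : ℤ) ≤ 9 * K ^ 3 := by linarith
      gcongr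
    have i3 : (C.length : ℤ) * n ≤ K * (5 * K ^ 2) := by gcongr
    have i4 : (C.length : ℤ) * |M.drift p x| ≤ K * K ^ 2 := by
      have := (M.abs_drift_le p x).trans hxz
      gcongr
    have i5 : |(C.length : ℤ) * M.drift p x| ≤ K * K ^ 2 := by
      rwa [abs_mul, Nat.abs_cast]
    have i6 := abs_le.1 i5
    have p1 : (0 : ℤ) ≤ b * x.length := by positivity
    have p2 : (0 : ℤ) ≤ b * δ' := by positivity
    have p3 : (0 : ℤ) ≤ C.length * n := by positivity
    have q1 : (K : ℤ) * K ^ 2 = K ^ 3 := by ring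
    have q2 : (K : ℤ) * (9 * K ^ 3) = 9 * K ^ 4 := by ring
    have q3 : (K : ℤ) * (5 * K ^ 2) = 5 * K ^ 3 := by ring
    rw [q1] at i1 i6
    rw [q2] at i2
    rw [q3] at i3
    rw [abs_le]
    constructor <;> linarith [i6.1, i6.2]

/-- The counters of two configurations at the same distance lie in one of few belts. -/
theorem exists_belt {c d : Config S F} {δ : ℕ} (hc : M.HasDist c δ) (hd : M.HasDist d δ) :
    ∃ X Y : ℕ, 1 ≤ X ∧ X ≤ Fintype.card S ^ 2 ∧ 1 ≤ Y ∧ Y ≤ Fintype.card S ^ 2 ∧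
      |(X : ℤ) * c.counter - Y * d.counter| ≤ 22 * (Fintype.card S : ℤ) ^ 5 := by
  obtain ⟨ℓ, b, h1, h2, h3, h4, h5⟩ := hc.exists_slope
  obtain ⟨ℓ', b', h1', h2', h3', h4', h5'⟩ := hd.exists_slope
  set K := Fintype.card S with hK
  refine ⟨ℓ * b', ℓ' * b, Nat.mul_pos h1 h3', ?_, Nat.mul_pos h1' h3, ?_, ?_⟩
  · rw [sq]; exact Nat.mul_le_mul h2 h4'
  · rw [sq]; exact Nat.mul_le_mul h2' h4
  · have e : ((ℓ * b' : ℕ) : ℤ) * c.counter - (ℓ' * b : ℕ) * d.counter =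
        b * (b' * δ - ℓ' * d.counter) - b' * (b * δ - ℓ * c.counter) := by push_cast; ring
    rw [e]
    refine (abs_sub _ _).trans ?_
    rw [abs_mul, abs_mul, Nat.abs_cast, Nat.abs_cast]
    have i1 : (b : ℤ) ≤ K := by exact_mod_cast h4
    have i2 : (b' : ℤ) ≤ K := by exact_mod_cast h4'
    calc (b : ℤ) * |(b' : ℤ) * δ - ℓ' * d.counter| + b' * |(b : ℤ) * δ - ℓ * c.counter|
        ≤ K * (11 * K ^ 4) + K * (11 * K ^ 4) := by gcongr
      _ = 22 * (K : ℤ) ^ 5 := by ring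

/-- High up, nearby belts have the same direction. -/
theorem belt_unique {x y X Y K : ℕ} {m n W E : ℤ} (hxy : Nat.Coprime x y) (hK' : y ≤ K)
    (hYK : Y ≤ K) (hX : 1 ≤ X) (hx : 1 ≤ x) (hW : 0 ≤ W) (hE : 0 ≤ E)
    (h : |x * m - y * n| ≤ W + E) (h' : |X * m - Y * n| ≤ W) (hm : K * (2 * W + E) < m) :
    |x * m - y * n| ≤ W := by
  -- The right side is smaller than `m`, so the integer factor on the left vanishes and the
  -- directions are proportional.
  have h1 : ((Y : ℤ) * x - y * X) * m = Y * (x * m - y * n) - y * (X * m - Y * n) := by ring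
  have h2 : |((Y : ℤ) * x - y * X) * m| ≤ K * (2 * W + E) := by
    rw [h1]
    refine (abs_sub _ _).trans ?_
    rw [abs_mul, abs_mul, Nat.abs_cast, Nat.abs_cast]
    have i1 : (Y : ℤ) ≤ K := by exact_mod_cast hYK
    have i2 : (y : ℤ) ≤ K := by exact_mod_cast hK'
    calc (Y : ℤ) * |(x : ℤ) * m - y * n| + y * |(X : ℤ) * m - Y * n|
        ≤ K * (W + E) + K * W := by gcongr
      _ = K * (2 * W + E) := by ring
  have hm0 : 0 < m := lt_of_le_of_lt (by positivity) hm
  have h3 : (Y : ℤ) * x - y * X = 0 := by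
    by_contra hne
    have h4 : 1 ≤ |(Y : ℤ) * x - y * X| := Int.one_le_abs hne
    rw [abs_mul, abs_of_pos hm0] at h2
    nlinarith
  have h4 : Y * x = y * X := by
    have : (Y : ℤ) * x = y * X := by linarith
    exact_mod_cast this
  -- By coprimality `(X, Y) = g (x, y)` with `g ≥ 1`, so the bound for the larger multiple passes to
  -- the offset of `(x, y)`.
  have hdvd : x ∣ X := hxy.dvd_of_dvd_mul_left (Dvd.intro_left Y h4)
  obtain ⟨g, rfl⟩ := hdvd
  have hYg : Y = y * g := by
    have : x * Y = x * (y * g) := by rw [mul_comm x Y, h4]; ring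
    exact Nat.eq_of_mul_eq_mul_left hx this
  subst hYg
  have hg : 1 ≤ g := by
    rcases Nat.eq_zero_or_pos g with h0 | h0
    · subst h0; omega
    · exact h0
  have h5 : ((x * g : ℕ) : ℤ) * m - (y * g : ℕ) * n = g * (x * m - y * n) := by push_cast; ring
  rw [h5, abs_mul, Nat.abs_cast] at h'
  have hg' : (1 : ℤ) ≤ g := by exact_mod_cast hg
  nlinarith [abs_nonneg ((x : ℤ) * m - y * n)]

/-- The direction of a belt may be taken with coprime entries. -/
theorem exists_coprime_belt {X Y K : ℕ} {m n W : ℤ} (hX : 1 ≤ X) (hXK : X ≤ K) (hY : 1 ≤ Y)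
    (hYK : Y ≤ K) (h : |X * m - Y * n| ≤ W) :
    ∃ x y : ℕ, Nat.Coprime x y ∧ 1 ≤ x ∧ x ≤ K ∧ 1 ≤ y ∧ y ≤ K ∧ |x * m - y * n| ≤ W := by
  obtain ⟨g, x, y, hg, hxy, rfl, rfl⟩ := Nat.exists_coprime' (m := X) (n := Y)
    (Nat.gcd_pos_of_pos_left _ hX)
  have hx : 1 ≤ x := Nat.pos_of_mul_pos_right hX
  have hy : 1 ≤ y := Nat.pos_of_mul_pos_right hY
  refine ⟨x, y, hxy, hx, (Nat.le_mul_of_pos_right x hg).trans hXK, hy,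
    (Nat.le_mul_of_pos_right y hg).trans hYK, ?_⟩
  have h5 : ((x * g : ℕ) : ℤ) * m - (y * g : ℕ) * n = g * (x * m - y * n) := by push_cast; ring
  rw [h5, abs_mul, Nat.abs_cast] at h
  have hg' : (1 : ℤ) ≤ g := by exact_mod_cast hg
  nlinarith [abs_nonneg ((x : ℤ) * m - y * n)]

end Slopes
end DWROCA

namespace DWROCA

/-! ### Translating a pair with unequal distances along its belt -/

section Tail

variable {S α F : Type*} [Field F] [Fintype S] {M : DWROCA S α F}

set_option maxHeartbeats 1000000 in
/-- A minimal distinguishing word does not leave a belt high up when the configurations there can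
be translated down along the belt. -/
theorem false_of_translate {p q : S} {m n : ℕ} {s t : F} {δ L N x y : ℕ}
    (hxy : Nat.Coprime x y) (hx : 1 ≤ x) (hxK : x ≤ Fintype.card S ^ 2) (hy : 1 ≤ y)
    (hyK : y ≤ Fintype.card S ^ 2) (hc : M.HasDist ⟨p, m, s⟩ δ)
    (hd : ∀ u, M.Special (M.run ⟨q, n, t⟩ u) → δ < u.length) (hL : L = N + δ + depth S)
    (hbelt : |(x : ℤ) * m - y * n| ≤ 22 * (Fintype.card S : ℤ) ^ 5 + 2 * (Fintype.card S : ℤ) ^ 2)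
    (hcut : ∀ B : ℕ, 1 ≤ B → B ≤ Fintype.card S ^ 2 → ∃ (m' n' N' : ℕ) (s' t' : F), m' < m ∧
      (B : ℤ) ∣ m - m' ∧ (x : ℤ) * (m - m') = y * (n - n') ∧ 100 * Fintype.card S ^ 7 ≤ m' ∧
      100 * Fintype.card S ^ 7 ≤ n' ∧ s' ≠ 0 ∧ (t = 0 → t' = 0) ∧ N' < N ∧
      ∀ u v : List α, M.behaviour (M.run ⟨p, m', s'⟩ u) v ≠ M.behaviour (M.run ⟨q, n', t'⟩ u) v →
        L ≤ N' + u.length + v.length) : False := by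
  set K := Fintype.card S with hK
  have hKpos : 0 < K := Fintype.card_pos_iff.2 ⟨p⟩
  have hk1 : (1 : ℤ) ≤ K := by exact_mod_cast hKpos
  have k27 : (K : ℤ) ^ 2 ≤ K ^ 7 := pow_le_pow_right₀ hk1 (by norm_num)
  have k24 : (K : ℤ) ^ 2 ≤ K ^ 4 := pow_le_pow_right₀ hk1 (by norm_num)
  have k47 : (K : ℤ) ^ 4 ≤ K ^ 7 := pow_le_pow_right₀ hk1 (by norm_num)
  have k57 : (K : ℤ) ^ 5 ≤ K ^ 7 := pow_le_pow_right₀ hk1 (by norm_num)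
  have k67 : (K : ℤ) ^ 6 ≤ K ^ 7 := pow_le_pow_right₀ hk1 (by norm_num)
  have k07 : (1 : ℤ) ≤ K ^ 7 := one_le_pow₀ hk1
  have k05 : (0 : ℤ) < K ^ 5 := by positivity
  have hxz : (x : ℤ) ≤ K ^ 2 := by exact_mod_cast hxK
  have hyz : (y : ℤ) ≤ K ^ 2 := by exact_mod_cast hyK
  have hx1 : (1 : ℤ) ≤ x := by exact_mod_cast hx
  have hy1 : (1 : ℤ) ≤ y := by exact_mod_cast hy
  have hm6 : 6 * K ^ 2 ≤ m := by
    obtain ⟨m', -, -, -, -, h1, -, -, h2, -⟩ := hcut 1 le_rfl (Nat.pow_pos hKpos)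
    have h2' : (100 : ℤ) * K ^ 7 ≤ m' := by exact_mod_cast h2
    have h1' : (m' : ℤ) < m := by exact_mod_cast h1
    have : (6 : ℤ) * K ^ 2 ≤ m := by linarith
    exact_mod_cast this
  obtain ⟨x0, C, b, J, hx0, hC1, hC2, hb1, hb2, hCs, hwx, hwC, hCd, -, hJ2, hJ⟩ :=
    hc.exists_cycle hm6
  rw [← hK] at hx0 hC2 hb2 hJ2
  set v := M.posState p x0 with hv
  -- Under repetition of the best cycle `C` of the first configuration, the state of the second
  -- becomes periodic. The preperiod goes into `X1`, and `E` is one period, closed for both.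
  obtain ⟨i1, i2, -, hi12, hi2, hper⟩ := exists_two_eq (a := 0) (b := K + 1)
    (Finset.univ : Finset S) (fun i => M.posState q (x0 ++ wordPow C i))
    (fun _ _ _ => Finset.mem_univ _) (by rw [Finset.card_univ]; omega)
  obtain ⟨f, rfl⟩ : ∃ f, i2 = i1 + f := ⟨i2 - i1, by omega⟩
  set X1 := x0 ++ wordPow C i1 with hX1
  set E := wordPow C f with hE
  set q1 := M.posState q X1 with hq1
  have hqE : M.posState q1 E = q1 := by
    rw [wordPow_add, ← List.append_assoc, posState_append] at hper
    exact hper.symm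
  have hvE : M.posState v E = v := M.posState_wordPow hCs f
  have hvEd : M.drift v E = -(f * b : ℤ) := by rw [M.drift_wordPow hCs, hCd]; ring
  have hpX1 : M.posState p X1 = v := by rw [posState_append, ← hv, M.posState_wordPow hCs]
  have hpX1d : M.drift p X1 = M.drift p x0 - i1 * b := by
    rw [drift_append, ← hv, M.drift_wordPow hCs, hCd]; ring
  have hX1len : X1.length = x0.length + i1 * C.length := by
    rw [List.length_append, length_wordPow]
  have hElen : E.length = f * C.length := length_wordPow C f
  have hf1 : 1 ≤ f := by omega
  have hX1K : X1.length ≤ 2 * K ^ 2 := by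
    have : i1 * C.length ≤ K * K := Nat.mul_le_mul (by omega) hC2
    rw [hX1len, two_mul]
    exact Nat.add_le_add hx0 (by rwa [sq])
  have hEK : E.length ≤ K ^ 2 := by rw [hElen, sq]; exact Nat.mul_le_mul (by omega) hC2
  have hfbK : f * b ≤ K ^ 2 := by rw [sq]; exact Nat.mul_le_mul (by omega) hb2
  have hX1z : (X1.length : ℤ) ≤ 2 * K ^ 2 := by exact_mod_cast hX1K
  have hEz : (E.length : ℤ) ≤ K ^ 2 := by exact_mod_cast hEK
  have hfbz : (f : ℤ) * b ≤ K ^ 2 := by exact_mod_cast hfbK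
  have hfb1 : (1 : ℤ) ≤ f * b := by exact_mod_cast Nat.mul_pos hf1 hb1
  -- One round of `E` costs the first configuration `f * b`, so with `B = f * b` the translation
  -- amounts to `τ` rounds.
  obtain ⟨m', n', N', s', t', hm', hdvd, hsl, hm'1, hn'1, hs', ht', hN', hmin⟩ :=
    hcut (f * b) (Nat.mul_pos hf1 hb1) hfbK
  have hm'z : (100 : ℤ) * K ^ 7 ≤ m' := by exact_mod_cast hm'1
  have hn'z : (100 : ℤ) * K ^ 7 ≤ n' := by exact_mod_cast hn'1
  obtain ⟨τ', hτ'⟩ := hdvd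
  push_cast at hτ'
  have hm'm : (m' : ℤ) < m := by exact_mod_cast hm'
  have hτ0 : 0 < τ' := by
    by_contra hneg
    have : (f * b : ℤ) * τ' ≤ 0 := mul_nonpos_of_nonneg_of_nonpos (by linarith) (by linarith)
    linarith
  obtain ⟨τ, rfl⟩ := Int.eq_ofNat_of_zero_le hτ0.le
  have habsp := abs_le.1 (M.abs_drift_le p X1)
  have habsq := abs_le.1 (M.abs_drift_le q X1)
  set μ : ℕ → ℤ := fun i => m' + M.drift p X1 - i * (f * b) with hμ
  set ν : ℕ → ℤ := fun i => n' + M.drift q X1 + i * M.drift q1 E with hν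
  -- More rounds than the belt is wide. They cost at most `44K⁷ + K²`, so from `100K⁷` the counter
  -- stays above the `50K⁷` needed for `belt_unique`.
  set T := 44 * K ^ 5 + 1 with hT
  have hTz : (T : ℤ) = 44 * K ^ 5 + 1 := by rw [hT]; push_cast; ring
  have hμ50 : ∀ i ≤ T, 50 * (K : ℤ) ^ 7 < μ i := by
    intro i hi
    have h1 : (i : ℤ) ≤ 44 * K ^ 5 + 1 := by rw [← hTz]; exact_mod_cast hi
    have h2 : (i : ℤ) * (f * b) ≤ (44 * K ^ 5 + 1) * K ^ 2 :=
      mul_le_mul h1 hfbz (by linarith) (by positivity)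
    have h3 : ((44 : ℤ) * K ^ 5 + 1) * K ^ 2 = 44 * K ^ 7 + K ^ 2 := by ring
    simp only [hμ]
    linarith
  -- After `i` rounds the translated first configuration is, up to weight, the original one after `τ
  -- + i` rounds of its shortest path.
  have hdistc : ∀ i ≤ T, ∃ δ', M.HasDist ⟨v, (μ i).toNat, 1⟩ δ' ∧
      δ = X1.length + (τ + i) * E.length + δ' := by
    intro i hi
    have hidx : i1 + f * (τ + i) ≤ J := by
      by_contra hlt
      push Not at hlt
      have h1 : (J : ℤ) * b ≤ (i1 + f * (τ + i)) * b := by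
        have : (J : ℤ) ≤ i1 + f * (τ + i) := by exact_mod_cast hlt.le
        gcongr
      have h2 := hμ50 i hi
      simp only [hμ, hpX1d] at h2
      have e : ((i1 : ℤ) + f * (τ + i)) * b = i1 * b + f * b * τ + i * (f * b) := by ring
      rw [e] at h1
      linarith
    obtain ⟨n, δ', h1, h2, h3⟩ := hJ _ hidx
    refine ⟨δ', ?_, ?_⟩
    · convert h2 using 2
      have : μ i = n := by
        simp only [hμ]
        rw [h1, hpX1d]
        push_cast
        linear_combination -hτ'
      omega
    · rw [h3, hX1len, hElen]
      ring
  have hwX1 : M.posWeight p X1 ≠ 0 := by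
    rw [posWeight_append, ← hv, M.posWeight_wordPow hCs]
    exact mul_ne_zero hwx (pow_ne_zero _ hwC)
  have hwE : M.posWeight v E ≠ 0 := by
    rw [M.posWeight_wordPow hCs]; exact pow_ne_zero _ hwC
  have hrunc : ∀ i ≤ T, M.run ⟨p, m', s'⟩ (X1 ++ wordPow E i) =
      ⟨v, (μ i).toNat, s' * M.posWeight p (X1 ++ wordPow E i)⟩ := by
    intro i hi
    have hA : M.Above p m' (X1 ++ wordPow E i) := by
      rw [above_append, hpX1]
      refine ⟨M.above_of_length_lt (by linarith), M.above_wordPow hvE (by linarith) ?_⟩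
      intro j hj
      have h1 := hμ50 j (by omega)
      simp only [hμ] at h1
      rw [hvEd]
      linarith
    rw [M.run_eq_of_above hA, posState_append, hpX1, M.posState_wordPow hvE, drift_append, hpX1,
      M.drift_wordPow hvE, hvEd]
    congr 2
    simp only [hμ]
    ring
  -- With unequal distances the translated pair would be distinguished within `δ' + depth` further
  -- letters, too early for `hmin` because `N' < N`.
  have hdistd : ∀ i ≤ T, ∃ δ', M.HasDist (M.run ⟨p, m', s'⟩ (X1 ++ wordPow E i)) δ' ∧
      M.HasDist (M.run ⟨q, n', t'⟩ (X1 ++ wordPow E i)) δ' ∧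
      δ = X1.length + (τ + i) * E.length + δ' := by
    intro i hi
    obtain ⟨δ', h1, h2⟩ := hdistc i hi
    have h3 : M.HasDist (M.run ⟨p, m', s'⟩ (X1 ++ wordPow E i)) δ' := by
      rw [hrunc i hi]
      refine h1.scale (mul_ne_zero hs' ?_)
      rw [posWeight_append, hpX1, M.posWeight_wordPow hvE]
      exact mul_ne_zero hwX1 (pow_ne_zero _ hwE)
    refine ⟨δ', h3, ?_, h2⟩
    by_contra hnot
    obtain ⟨w, hw, hne⟩ := exists_ne_of_not_hasDist h3 hnot
    have h4 := hmin _ _ hne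
    rw [List.length_append, length_wordPow] at h4
    have h5 : (τ + i) * E.length = τ * E.length + i * E.length := add_mul _ _ _
    omega
  have hx0 : (0 : ℤ) ≤ x := by positivity
  have hy0 : (0 : ℤ) ≤ y := by positivity
  have hkk : (K : ℤ) ^ 2 * K ^ 2 = K ^ 4 := by ring
  -- Equal distances turn a rough bound on the offset back into the exact one. The second counter
  -- then has room for one more round, which drives the induction `hind`.
  have hstep : ∀ i ≤ T, |(x : ℤ) * μ i - y * ν i| ≤ 22 * (K : ℤ) ^ 5 + 6 * K ^ 4 →
      M.Above q n' (X1 ++ wordPow E i) →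
      |(x : ℤ) * μ i - y * ν i| ≤ 22 * (K : ℤ) ^ 5 ∧ (K : ℤ) ^ 2 < ν i ∧
        M.run ⟨q, n', t'⟩ (X1 ++ wordPow E i) =
          ⟨q1, (ν i).toNat, t' * M.posWeight q (X1 ++ wordPow E i)⟩ := by
    intro i hi hb hA
    have hrun : M.run ⟨q, n', t'⟩ (X1 ++ wordPow E i) =
          ⟨q1, (ν i).toNat, t' * M.posWeight q (X1 ++ wordPow E i)⟩ := by
      rw [M.run_eq_of_above hA, posState_append, ← hq1, M.posState_wordPow hqE, drift_append,
        ← hq1, M.drift_wordPow hqE]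
      congr 2
      simp only [hν]
      ring
    have hνpos : 0 < ν i := by
      have h1 := hA _ List.prefix_rfl
      rw [drift_append, ← hq1, M.drift_wordPow hqE] at h1
      simp only [hν]
      linarith
    have hμi := hμ50 i hi
    obtain ⟨δ', h1, h2, -⟩ := hdistd i hi
    obtain ⟨X, Y, hX1, hX2, hY1, hY2, hXY⟩ := exists_belt h1 h2
    rw [hrun, hrunc i hi] at hXY
    simp only [← hK] at hXY hX2 hY2
    rw [Int.toNat_of_nonneg hνpos.le, Int.toNat_of_nonneg (by linarith)] at hXY
    have hW := belt_unique (K := K ^ 2) hxy hyK hY2 hX1 hx (by positivity) (by positivity)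
      hb hXY (by
        push_cast
        have : (K : ℤ) ^ 2 * (2 * (22 * K ^ 5) + 6 * K ^ 4) = 44 * K ^ 7 + 6 * K ^ 6 := by ring
        rw [this]
        linarith)
    refine ⟨hW, ?_, hrun⟩
    by_contra hlt
    push Not at hlt
    have h3 : (y : ℤ) * ν i ≤ K ^ 2 * K ^ 2 := mul_le_mul hyz hlt hνpos.le (by positivity)
    have h4 : μ i ≤ x * μ i := le_mul_of_one_le_left (by linarith) hx1
    have h5 := (abs_le.1 hW).2
    linarith
  have hdE := abs_le.1 (M.abs_drift_le q1 E)
  have hind : ∀ i ≤ T, |(x : ℤ) * μ i - y * ν i| ≤ 22 * (K : ℤ) ^ 5 ∧ (K : ℤ) ^ 2 < ν i ∧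
      M.run ⟨q, n', t'⟩ (X1 ++ wordPow E i) =
        ⟨q1, (ν i).toNat, t' * M.posWeight q (X1 ++ wordPow E i)⟩ ∧
      M.Above q n' (X1 ++ wordPow E i) := by
    intro i hi
    induction i with
    | zero =>
      have hA : M.Above q n' (X1 ++ wordPow E 0) := by
        rw [wordPow, List.append_nil]
        exact M.above_of_length_lt (by linarith)
      obtain ⟨h1, h2, h3⟩ := hstep 0 hi (by
        have e : (x : ℤ) * μ 0 - y * ν 0 =
            (x * m - y * n) + (x * M.drift p X1 - y * M.drift q X1) := by
          simp only [hμ, hν]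
          push_cast
          linear_combination -hsl
        rw [e]
        refine (abs_add_le _ _).trans ?_
        have h1 : |(x : ℤ) * M.drift p X1 - y * M.drift q X1| ≤ 4 * (K : ℤ) ^ 4 := by
          refine (abs_sub _ _).trans ?_
          rw [abs_mul, abs_mul, Nat.abs_cast, Nat.abs_cast]
          have h2 := (M.abs_drift_le p X1).trans hX1z
          have h3 := (M.abs_drift_le q X1).trans hX1z
          calc (x : ℤ) * |M.drift p X1| + y * |M.drift q X1|
              ≤ K ^ 2 * (2 * K ^ 2) + K ^ 2 * (2 * K ^ 2) := by gcongr
            _ = 4 * (K : ℤ) ^ 4 := by ring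
        linarith) hA
      exact ⟨h1, h2, h3, hA⟩
    | succ i ih =>
      obtain ⟨h1, h2, -, hA⟩ := ih (by omega)
      have hA' : M.Above q n' (X1 ++ wordPow E (i + 1)) := by
        rw [wordPow, ← List.append_assoc, above_append]
        refine ⟨hA, ?_⟩
        rw [posState_append, ← hq1, M.posState_wordPow hqE, drift_append, ← hq1,
          M.drift_wordPow hqE]
        refine M.above_of_length_lt ?_
        simp only [hν] at h2
        linarith
      obtain ⟨h3, h4, h5⟩ := hstep (i + 1) hi (by
        have e : (x : ℤ) * μ (i + 1) - y * ν (i + 1) =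
            (x * μ i - y * ν i) - (x * (f * b) + y * M.drift q1 E) := by
          simp only [hμ, hν]
          push_cast
          ring
        rw [e]
        refine (abs_sub _ _).trans ?_
        have h6 : |(x : ℤ) * (f * b) + y * M.drift q1 E| ≤ 2 * (K : ℤ) ^ 4 := by
          refine (abs_add_le _ _).trans ?_
          have e1 : |(x : ℤ) * (f * b)| = x * (f * b) := abs_of_nonneg (by positivity)
          rw [e1, abs_mul, Nat.abs_cast]
          have h3 := (M.abs_drift_le q1 E).trans hEz
          calc (x : ℤ) * (f * b) + y * |M.drift q1 E|
              ≤ K ^ 2 * K ^ 2 + K ^ 2 * K ^ 2 := by gcongr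
            _ = 2 * (K : ℤ) ^ 4 := by ring
        have h7 : (0 : ℤ) ≤ K ^ 4 := by positivity
        linarith) hA'
      exact ⟨h3, h4, h5, hA'⟩
  have hT1 : 1 ≤ T := by omega
  -- A nonzero change of offset per round would add up to more than the width `44K⁵` in `T` rounds.
  have hslope : (x : ℤ) * (f * b) + y * M.drift q1 E = 0 := by
    by_contra hne
    have h1 := Int.one_le_abs hne
    have h2 := (hind T le_rfl).1
    have h3 := (hind 0 (Nat.zero_le _)).1
    have e : (T : ℤ) * (x * (f * b) + y * M.drift q1 E) =
        (x * μ 0 - y * ν 0) - (x * μ T - y * ν T) := by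
      simp only [hμ, hν]
      push_cast
      ring
    have h4 : (T : ℤ) * |(x : ℤ) * (f * b) + y * M.drift q1 E| ≤ 44 * K ^ 5 := by
      rw [← Nat.abs_cast T, ← abs_mul, e]
      refine (abs_sub _ _).trans ?_
      linarith
    rw [hTz] at h4
    have h5 := mul_le_mul_of_nonneg_left h1 (by positivity : (0 : ℤ) ≤ 44 * K ^ 5 + 1)
    linarith
  -- So `τ` rounds undo the translation of the second counter too: the original reads `X1 E^τ` to
  -- where its translate is after `X1`.
  have hnn : (n : ℤ) = n' - τ * M.drift q1 E := by
    have h1 : (y : ℤ) * n = y * (n' - τ * M.drift q1 E) := by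
      linear_combination -hsl + x * hτ' + τ * hslope
    exact mul_left_cancel₀ (by linarith : (y : ℤ) ≠ 0) h1
  have hdEneg : M.drift q1 E ≤ 0 := by
    by_contra hpos
    have : 0 < (y : ℤ) * M.drift q1 E := mul_pos (by linarith) (by linarith)
    have : 0 < (x : ℤ) * (f * b) := mul_pos (by linarith) (by linarith)
    linarith
  have hτE : (τ : ℤ) * M.drift q1 E ≤ 0 := mul_nonpos_of_nonneg_of_nonpos (by positivity) hdEneg
  obtain ⟨-, hν0, hrun0, -⟩ := hind 0 (Nat.zero_le _)
  obtain ⟨δ0, -, hd0, hδ0⟩ := hdistd 0 (Nat.zero_le _)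
  obtain ⟨δ1, -, hd1, -⟩ := hdistd 1 hT1
  have hrun1 := (hind 1 hT1).2.2.1
  rw [hrun0] at hd0
  rw [hrun1] at hd1
  have hw1 := hd1.weight_ne_zero
  simp only [wordPow, List.nil_append, posWeight_append, ← hq1] at hw1
  have hAd : M.Above q n (X1 ++ wordPow E τ) := by
    rw [above_append, ← hq1]
    refine ⟨M.above_of_length_lt (by linarith), M.above_wordPow hqE (by linarith) ?_⟩
    intro j hj
    have h1 : (τ : ℤ) * M.drift q1 E ≤ j * M.drift q1 E :=
      mul_le_mul_of_nonpos_right (by exact_mod_cast hj.le) hdEneg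
    simp only [hν] at hν0
    push_cast at hν0
    linarith
  have hrund := M.run_eq_of_above (s := t) hAd
  rw [posState_append, ← hq1, M.posState_wordPow hqE, drift_append, ← hq1,
    M.drift_wordPow hqE, posWeight_append, ← hq1, M.posWeight_wordPow hqE] at hrund
  have hνn : ((n : ℤ) + (M.drift q X1 + τ * M.drift q1 E)) = ν 0 := by
    simp only [hν]
    push_cast
    linear_combination hnn
  rw [hνn] at hrund
  have ht : t ≠ 0 := fun h0 => left_ne_zero_of_mul hw1 (ht' h0)
  have hwq := right_ne_zero_of_mul hw1
  have hfin := hd0.scale (mul_ne_zero ht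
    (mul_ne_zero (left_ne_zero_of_mul hwq) (pow_ne_zero τ (right_ne_zero_of_mul hwq))))
  rw [← hrund] at hfin
  -- The second configuration thus reaches a special one in exactly `δ` letters, against `hd`.
  obtain ⟨⟨u, hu, hsp⟩, -⟩ := hfin
  have := hd (X1 ++ wordPow E τ ++ u) (by rwa [run_append])
  rw [List.length_append, List.length_append, length_wordPow, hu] at this
  rw [add_zero] at hδ0
  omega

end Tail
end DWROCA

namespace DWROCA

/-! ### Cutting words and the rank argument -/

section Cuts

variable {S α F : Type*} [Field F]

/-- Three pairs of vectors in the plane cannot be in triangular position. -/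
theorem false_of_triangular {f f' b b' : Fin 3 → F} (h : ∀ i, f i * b i ≠ f' i * b' i)
    (h01 : f 0 * b 1 = f' 0 * b' 1) (h02 : f 0 * b 2 = f' 0 * b' 2)
    (h12 : f 1 * b 2 = f' 1 * b' 2) : False := by
  -- The matrix of `f i * b j - f' i * b' j` has rank at most two, so it cannot be triangular with
  -- nonzero diagonal. Concretely, independent first rows would force the last column pair to
  -- vanish; dependent ones force the first row to vanish.
  have e1 : (f 0 * f' 1 - f' 0 * f 1) * b 2 = 0 := by
    linear_combination f' 1 * h02 - f' 0 * h12
  have e2 : (f 0 * f' 1 - f' 0 * f 1) * b' 2 = 0 := by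
    linear_combination f 1 * h02 - f 0 * h12
  have e3 : f 0 * f' 1 - f' 0 * f 1 = 0 := by
    by_contra hne
    have h1 := (mul_eq_zero.1 e1).resolve_left hne
    have h2 := (mul_eq_zero.1 e2).resolve_left hne
    exact h 2 (by rw [h1, h2, mul_zero, mul_zero])
  have e4 : f 0 * (f 1 * b 1 - f' 1 * b' 1) = 0 := by
    linear_combination f 1 * h01 - b' 1 * e3
  have e5 : f' 0 * (f 1 * b 1 - f' 1 * b' 1) = 0 := by
    linear_combination f' 1 * h01 - b 1 * e3
  have e6 : f 1 * b 1 - f' 1 * b' 1 ≠ 0 := sub_ne_zero.2 (h 1)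
  have h1 := (mul_eq_zero.1 e4).resolve_right e6
  have h2 := (mul_eq_zero.1 e5).resolve_right e6
  exact h 0 (by rw [h1, h2, zero_mul, zero_mul])

variable (M : DWROCA S α F)

/-- A stretch of a run that stays above `r` can be read `r` lower. -/
theorem run_translate {c : Config S F} {w : List α} {i j r : ℕ} (hij : i ≤ j) (hj : j ≤ w.length)
    (H : ∀ k, i ≤ k → k ≤ j → r < (M.run c (w.take k)).counter) (s : F) :
    M.run ⟨(M.run c (w.take i)).state, (M.run c (w.take i)).counter - r, s⟩ (factor w i j) =
      ⟨(M.run c (w.take j)).state, (M.run c (w.take j)).counter - r,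
        s * M.posWeight (M.run c (w.take i)).state (factor w i j)⟩ := by
  obtain ⟨hA, hcnt, hst, -⟩ := M.above_factor hij hj (d := r) (by positivity)
    (fun k h1 h2 => by exact_mod_cast H k h1 h2)
  have h1 := H i le_rfl hij
  have h2 := H j hij le_rfl
  have h3 : ((M.run c (w.take i)).counter : ℤ) - r =
      (((M.run c (w.take i)).counter - r : ℕ) : ℤ) := by omega
  rw [h3] at hA
  rw [M.run_eq_of_above hA, hst]
  congr 1
  omega

/-- The value of a word from which parts of an ascent and of a descent have been cut. -/
theorem behaviour_cut {c : Config S F} {w : List α} {u u' d d' r : ℕ} (hu : u' ≤ d')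
    (hd : d' ≤ w.length)
    (hsu : (M.run c (w.take u)).state = (M.run c (w.take u')).state)
    (hcu : (M.run c (w.take u)).counter + r = (M.run c (w.take u')).counter)
    (hsd : (M.run c (w.take d)).state = (M.run c (w.take d')).state)
    (hcd : (M.run c (w.take d)).counter + r = (M.run c (w.take d')).counter)
    (H : ∀ k, u' ≤ k → k ≤ d' → r < (M.run c (w.take k)).counter) :
    M.behaviour c (w.take u ++ (factor w u' d' ++ w.drop d)) =
      (M.run c (w.take u)).weight * M.behaviour ⟨(M.run c (w.take d)).state,
        (M.run c (w.take d)).counter, 1⟩ (w.drop d) *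
      M.posWeight (M.run c (w.take u')).state (factor w u' d') := by
  have h := M.run_translate hu hd H (M.run c (w.take u)).weight
  rw [← hsu, ← hsd, ← hcu, ← hcd, Nat.add_sub_cancel, Nat.add_sub_cancel] at h
  rw [behaviour_append, behaviour_append,
    show M.run c (w.take u) = ⟨(M.run c (w.take u)).state, (M.run c (w.take u)).counter,
      (M.run c (w.take u)).weight⟩ from rfl, h, behaviour_eq_mul, ← hsu]
  ring

/-- The value of a word from which a part of an ascent has been cut. -/
theorem behaviour_cut_suffix {c : Config S F} {w : List α} {u u' r : ℕ} (hu : u' ≤ w.length)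
    (hsu : (M.run c (w.take u)).state = (M.run c (w.take u')).state)
    (hcu : (M.run c (w.take u)).counter + r = (M.run c (w.take u')).counter)
    (H : ∀ k, u' ≤ k → k ≤ w.length → r < (M.run c (w.take k)).counter) :
    M.behaviour c (w.take u ++ factor w u' w.length) =
      (M.run c (w.take u)).weight * M.final (M.run c w).state *
      M.posWeight (M.run c (w.take u')).state (factor w u' w.length) := by
  have h := M.run_translate hu le_rfl H (M.run c (w.take u)).weight
  rw [← hsu, ← hcu, Nat.add_sub_cancel, List.take_length] at h
  rw [behaviour_append, behaviour,
    show M.run c (w.take u) = ⟨(M.run c (w.take u)).state, (M.run c (w.take u)).counter,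
      (M.run c (w.take u)).weight⟩ from rfl, h, ← hsu]
  simp only
  ring

/-- The value of a word from which the factor between two visits of a configuration is cut. -/
theorem behaviour_cut_loop {c : Config S F} {w : List α} {u u' : ℕ}
    (hsu : (M.run c (w.take u)).state = (M.run c (w.take u')).state)
    (hcu : (M.run c (w.take u)).counter = (M.run c (w.take u')).counter) :
    M.behaviour c (w.take u ++ w.drop u') = (M.run c (w.take u)).weight *
      M.behaviour ⟨(M.run c (w.take u')).state, (M.run c (w.take u')).counter, 1⟩
        (w.drop u') := by
  rw [behaviour_append, behaviour_eq_mul, hsu, hcu]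

/-- The word `w` is a shortest word that distinguishes two configurations. -/
structure MinimalWitness (c d : Config S F) (w : List α) : Prop where
  ne : M.behaviour c w ≠ M.behaviour d w
  min : ∀ v : List α, M.behaviour c v ≠ M.behaviour d v → w.length ≤ v.length

variable {M}

theorem MinimalWitness.eq_of_length_lt {c d : Config S F} {w v : List α}
    (h : M.MinimalWitness c d w) (hv : v.length < w.length) :
    M.behaviour c v = M.behaviour d v := by
  by_contra hne
  exact absurd (h.min v hne) (by omega)

theorem MinimalWitness.symm {c d : Config S F} {w : List α}
    (h : M.MinimalWitness c d w) : M.MinimalWitness d c w :=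
  ⟨h.ne.symm, fun v hv => h.min v hv.symm⟩

/-- A minimal witness visits no pair of configurations three times. -/
theorem MinimalWitness.no_loop {c d : Config S F} {w : List α} (h : M.MinimalWitness c d w)
    (i : Fin 3 → ℕ) (h01 : i 0 < i 1) (h12 : i 1 < i 2) (hi : i 2 ≤ w.length)
    (hc : ∀ j, (M.run c (w.take (i j))).state = (M.run c (w.take (i 0))).state ∧
      (M.run c (w.take (i j))).counter = (M.run c (w.take (i 0))).counter)
    (hd : ∀ j, (M.run d (w.take (i j))).state = (M.run d (w.take (i 0))).state ∧
      (M.run d (w.take (i j))).counter = (M.run d (w.take (i 0))).counter) : False := by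
  have key : ∀ (c : Config S F),
      (∀ j, (M.run c (w.take (i j))).state = (M.run c (w.take (i 0))).state ∧
      (M.run c (w.take (i j))).counter = (M.run c (w.take (i 0))).counter) → ∀ j k,
      M.behaviour c (w.take (i j) ++ w.drop (i k)) = (M.run c (w.take (i j))).weight *
      M.behaviour ⟨(M.run c (w.take (i k))).state, (M.run c (w.take (i k))).counter, 1⟩
        (w.drop (i k)) := fun c hc j k =>
    M.behaviour_cut_loop ((hc j).1.trans (hc k).1.symm) ((hc j).2.trans (hc k).2.symm)
  have hcut : ∀ j k, i j < i k → i k ≤ w.length →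
      M.behaviour c (w.take (i j) ++ w.drop (i k)) =
      M.behaviour d (w.take (i j) ++ w.drop (i k)) := fun j k h1 h2 =>
    h.eq_of_length_lt (by rw [List.length_append, List.length_take, List.length_drop]; omega)
  -- Entry `(j, k)` belongs to the word without the factor from `i j` to `i k`; on the diagonal this
  -- is `w` itself.
  refine false_of_triangular (f := fun j => (M.run c (w.take (i j))).weight)
    (f' := fun j => (M.run d (w.take (i j))).weight)
    (b := fun k => M.behaviour ⟨(M.run c (w.take (i k))).state,
      (M.run c (w.take (i k))).counter, 1⟩ (w.drop (i k)))
    (b' := fun k => M.behaviour ⟨(M.run d (w.take (i k))).state,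
      (M.run d (w.take (i k))).counter, 1⟩ (w.drop (i k))) ?_ ?_ ?_ ?_
  · intro j
    have := h.ne
    rwa [← List.take_append_drop (i j) w, key c hc, key d hd] at this
  · have := hcut 0 1 h01 (by omega)
    rwa [key c hc, key d hd] at this
  · have := hcut 0 2 (by omega) (by omega)
    rwa [key c hc, key d hd] at this
  · have := hcut 1 2 h12 (by omega)
    rwa [key c hc, key d hd] at this

end Cuts
end DWROCA

namespace DWROCA

/-! ### Excursions and climbs inside a belt -/

section Excursions

/-- The last times at which a climbing sequence has given values. -/
theorem exists_last_times {f : ℕ → ℕ} (hf : ∀ i, f (i + 1) ≤ f i + 1) {a b : ℕ} (hab : a ≤ b) :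
    ∃ U : ℕ → ℕ, ∀ x, f a ≤ x → x ≤ f b →
      a ≤ U x ∧ U x ≤ b ∧ f (U x) = x ∧ ∀ i, U x < i → i ≤ b → x < f i := by
  have : ∀ x, ∃ u, f a ≤ x → x ≤ f b →
      a ≤ u ∧ u ≤ b ∧ f u = x ∧ ∀ i, u < i → i ≤ b → x < f i := by
    intro x
    by_cases hx : f a ≤ x ∧ x ≤ f b
    · obtain ⟨u, hu⟩ := exists_last_eq hab (fun i _ _ => hf i) hx.1 hx.2
      exact ⟨u, fun _ _ => hu⟩
    · exact ⟨0, fun h1 h2 => absurd ⟨h1, h2⟩ hx⟩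
  choose U hU using this
  exact ⟨U, hU⟩

/-- The first times at which a falling sequence has given values. -/
theorem exists_first_times {f : ℕ → ℕ} (hf : ∀ i, f i ≤ f (i + 1) + 1) {a b : ℕ} (hab : a ≤ b) :
    ∃ D : ℕ → ℕ, ∀ x, f b ≤ x → x ≤ f a →
      a ≤ D x ∧ D x ≤ b ∧ f (D x) = x ∧ ∀ i, a ≤ i → i < D x → x < f i := by
  have : ∀ x, ∃ u, f b ≤ x → x ≤ f a →
      a ≤ u ∧ u ≤ b ∧ f u = x ∧ ∀ i, a ≤ i → i < u → x < f i := by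
    intro x
    by_cases hx : f b ≤ x ∧ x ≤ f a
    · obtain ⟨u, hu⟩ := exists_first_eq hab (fun i _ _ => hf i) hx.2 hx.1
      exact ⟨u, fun _ _ => hu⟩
    · exact ⟨0, fun h1 h2 => absurd ⟨h1, h2⟩ hx⟩
  choose D hD using this
  exact ⟨D, hD⟩

/-- Two points of a belt with the same offset. -/
theorem belt_shift {x y p q n n' W : ℕ} (hx : 1 ≤ x) (hy : 1 ≤ y) (hpq : p ≤ q)
    (he : (x : ℤ) * p - y * n = x * q - y * n') :
    n ≤ n' ∧ (p < q → n < n') ∧ (y : ℤ) * (n' - n) = x * (q - p) ∧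
    ∀ m k : ℕ, q ≤ m → |(x : ℤ) * m - y * k| ≤ W → (p : ℤ) - W ≤ y * (k - (n' - n)) := by
  have hx1 : (1 : ℤ) ≤ x := by exact_mod_cast hx
  have hy1 : (1 : ℤ) ≤ y := by exact_mod_cast hy
  have hpq' : (p : ℤ) ≤ q := by exact_mod_cast hpq
  have e : (y : ℤ) * (n' - n) = x * (q - p) := by linear_combination he
  refine ⟨?_, fun hlt => ?_, e, fun m k hm hb => ?_⟩
  · have h1 : 0 ≤ (y : ℤ) * (n' - n) := by
      rw [e]; exact mul_nonneg (by linarith) (by linarith)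
    have := nonneg_of_mul_nonneg_right h1 (by linarith)
    omega
  · have hlt' : (p : ℤ) < q := by exact_mod_cast hlt
    have h1 : 0 < (y : ℤ) * (n' - n) := by
      rw [e]; exact mul_pos (by linarith) (by linarith)
    have := pos_of_mul_pos_right h1 (by linarith)
    omega
  -- For `W < p` this keeps the second counter positive when its run is lowered along the belt.
  · have hm' : (q : ℤ) ≤ m := by exact_mod_cast hm
    have h1 := (abs_le.1 hb).2
    have h2 : (x : ℤ) * q ≤ x * m := mul_le_mul_of_nonneg_left hm' (by linarith)
    have h3 : (p : ℤ) ≤ x * p := le_mul_of_one_le_left (by positivity) hx1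
    rw [mul_sub, e]
    linarith

variable {S α F : Type*} [Field F] {M : DWROCA S α F}

/-- The pair of configurations reached after `N` letters can be reached by a shorter word with
counters that stay above `G` and are smaller by multiples of `B` in the proportion of `x` and `y`. -/
def Translates (M : DWROCA S α F) (c d : Config S F) (w : List α) (N x y G B : ℕ) : Prop :=
  ∃ (r r' : ℕ) (z : List α) (s t : F), 0 < r ∧ 0 < r' ∧ B ∣ r ∧ B ∣ r' ∧ x * r = y * r' ∧
    G + r ≤ (M.run c (w.take N)).counter ∧ G + r' ≤ (M.run d (w.take N)).counter ∧
    z.length < N ∧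
    M.run c z = ⟨(M.run c (w.take N)).state, (M.run c (w.take N)).counter - r, s⟩ ∧
    M.run d z = ⟨(M.run d (w.take N)).state, (M.run d (w.take N)).counter - r', t⟩ ∧
    (s = 0 ↔ (M.run c (w.take N)).weight = 0) ∧ (t = 0 ↔ (M.run d (w.take N)).weight = 0)

theorem Translates.symm {c d : Config S F} {w : List α} {N x y G B : ℕ}
    (h : M.Translates c d w N x y G B) : M.Translates d c w N y x G B := by
  obtain ⟨r, r', z, s, t, h1, h2, h3, h4, h5, h6, h7, h8, h9, h10, h11, h12⟩ := h
  exact ⟨r', r, z, t, s, h2, h1, h4, h3, h5.symm, h7, h6, h8, h10, h9, h12, h11⟩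

variable [Fintype S]

/-- The two configurations are at the same finite distance from the special configurations. -/
def SameDist (M : DWROCA S α F) (c d : Config S F) : Prop :=
  ∃ δ, M.HasDist c δ ∧ M.HasDist d δ

/-- High up, a stretch of a run through pairs of equal distance stays in one belt. -/
theorem exists_belt_along {c d : Config S F} {w : List α} {a e : ℕ} (hae : a ≤ e)
    (hgood : ∀ k, a ≤ k → k ≤ e → M.SameDist (M.run c (w.take k)) (M.run d (w.take k)))
    (hhigh : ∀ k, a ≤ k → k ≤ e → 50 * Fintype.card S ^ 7 < (M.run c (w.take k)).counter) :
    ∃ x y : ℕ, Nat.Coprime x y ∧ 1 ≤ x ∧ x ≤ Fintype.card S ^ 2 ∧ 1 ≤ y ∧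
      y ≤ Fintype.card S ^ 2 ∧ ∀ k, a ≤ k → k ≤ e →
      |(x : ℤ) * (M.run c (w.take k)).counter - y * (M.run d (w.take k)).counter| ≤
        22 * (Fintype.card S : ℤ) ^ 5 := by
  have hKpos : 0 < Fintype.card S := Fintype.card_pos_iff.2 ⟨c.state⟩
  set K := Fintype.card S with hK
  have hk1 : (1 : ℤ) ≤ K := by exact_mod_cast hKpos
  have k67 : (K : ℤ) ^ 6 ≤ K ^ 7 := pow_le_pow_right₀ hk1 (by norm_num)
  have k24 : (K : ℤ) ^ 2 ≤ K ^ 4 := pow_le_pow_right₀ hk1 (by norm_num)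
  have k7 : (0 : ℤ) ≤ K ^ 7 := by positivity
  obtain ⟨δ, h1, h2⟩ := hgood a le_rfl hae
  obtain ⟨X, Y, hX1, hX2, hY1, hY2, hXY⟩ := exists_belt h1 h2
  obtain ⟨x, y, hxy, hx1, hx2, hy1, hy2, hb⟩ := exists_coprime_belt hX1 hX2 hY1 hY2 hXY
  refine ⟨x, y, hxy, hx1, hx2, hy1, hy2, fun k hk => ?_⟩
  induction k, hk using Nat.le_induction with
  | base => exact fun _ => hb
  | succ k hk ih =>
    intro hke
    have hprev := ih (by omega)
    obtain ⟨δ', h3, h4⟩ := hgood (k + 1) (by omega) hke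
    obtain ⟨X', Y', hX1', -, -, hY2', hXY'⟩ := exists_belt h3 h4
    -- One letter changes the offset by at most `2K²`, well within the slack `6K⁴`; the height
    -- `50K⁷` covers `K²(44K⁵ + 6K⁴)`.
    refine belt_unique (K := K ^ 2) (E := 6 * K ^ 4) hxy hy2 hY2' hX1' hx1 (by positivity)
      (by positivity) ?_ hXY' ?_
    · have s1 := M.counter_take_succ c w k
      have s2 := M.counter_take_succ d w k
      have e1 : |((M.run c (w.take (k + 1))).counter : ℤ) - (M.run c (w.take k)).counter| ≤ 1 := by
        rw [abs_le]; omega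
      have e2 : |((M.run d (w.take (k + 1))).counter : ℤ) - (M.run d (w.take k)).counter| ≤ 1 := by
        rw [abs_le]; omega
      generalize ((M.run c (w.take (k + 1))).counter : ℤ) = A at *
      generalize ((M.run d (w.take (k + 1))).counter : ℤ) = B at *
      generalize ((M.run c (w.take k)).counter : ℤ) = A' at *
      generalize ((M.run d (w.take k)).counter : ℤ) = B' at *
      have e3 : x * A - y * B = (x * A' - y * B') + (x * (A - A') - y * (B - B')) := by ring
      rw [e3]
      refine (abs_add_le _ _).trans ?_
      have e4 : |x * (A - A') - y * (B - B')| ≤ 2 * (K : ℤ) ^ 2 := by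
        refine (abs_sub _ _).trans ?_
        rw [abs_mul, abs_mul, Nat.abs_cast, Nat.abs_cast]
        have i1 : (x : ℤ) ≤ K ^ 2 := by exact_mod_cast hx2
        have i2 : (y : ℤ) ≤ K ^ 2 := by exact_mod_cast hy2
        calc (x : ℤ) * |A - A'| + y * |B - B'| ≤ K ^ 2 * 1 + K ^ 2 * 1 := by gcongr
          _ = 2 * (K : ℤ) ^ 2 := by ring
      have k4 : (0 : ℤ) ≤ K ^ 4 := by positivity
      linarith
    · have h5 : ((50 * K ^ 7 : ℕ) : ℤ) < (M.run c (w.take (k + 1))).counter := by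
        exact_mod_cast hhigh (k + 1) (by omega) hke
      push_cast at h5 ⊢
      have e : (K : ℤ) ^ 2 * (2 * (22 * K ^ 5) + 6 * K ^ 4) = 44 * K ^ 7 + 6 * K ^ 6 := by ring
      rw [e]
      linarith

/-- A minimal witness makes no high excursion inside a belt. -/
theorem MinimalWitness.false_of_return {c d : Config S F} {w : List α}
    (h : M.MinimalWitness c d w) {a i e lo hi x y W : ℕ} (hai : a ≤ i) (hie : i ≤ e)
    (he : e ≤ w.length) (hx : 1 ≤ x) (hy : 1 ≤ y)
    (hbelt : ∀ k, a ≤ k → k ≤ e →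
      |(x : ℤ) * (M.run c (w.take k)).counter - y * (M.run d (w.take k)).counter| ≤ W)
    (hW : W < lo) (ha : (M.run c (w.take a)).counter ≤ lo)
    (hlo : (M.run c (w.take e)).counter ≤ lo) (hhi : hi ≤ (M.run c (w.take i)).counter)
    (hlev : lo + 2 * (Fintype.card S ^ 4 * (2 * W + 1) ^ 2) < hi) : False := by
  obtain ⟨U, hU⟩ := exists_last_times (f := fun k => (M.run c (w.take k)).counter)
    (fun k => (M.counter_take_succ c w k).1) hai
  obtain ⟨D, hD⟩ := exists_first_times (f := fun k => (M.run c (w.take k)).counter)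
    (fun k => (M.counter_take_succ c w k).2) hie
  -- Each level is labelled by the four states and the two offsets at its upward and downward
  -- crossings.
  obtain ⟨p1, p2, p3, hp1, hp12, hp23, hp3, ht1, ht2⟩ := exists_three_eq (a := lo) (b := hi)
    ((Finset.univ : Finset (S × S × S × S)) ×ˢ
      (Finset.Icc (-W : ℤ) W ×ˢ Finset.Icc (-W : ℤ) W))
    (fun z => (((M.run c (w.take (U z))).state, (M.run d (w.take (U z))).state,
      (M.run c (w.take (D z))).state, (M.run d (w.take (D z))).state),
      (x : ℤ) * (M.run c (w.take (U z))).counter - y * (M.run d (w.take (U z))).counter,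
      (x : ℤ) * (M.run c (w.take (D z))).counter - y * (M.run d (w.take (D z))).counter))
    (fun z hz1 hz2 => by
      obtain ⟨u1, u2, -, -⟩ := hU z (by omega) (by omega)
      obtain ⟨d1, d2, -, -⟩ := hD z (by omega) (by omega)
      simp only [Finset.mem_product, Finset.mem_univ, true_and, Finset.mem_Icc, ← abs_le]
      exact ⟨hbelt _ u1 (by omega), hbelt _ (by omega) d2⟩)
    (by
      rw [Finset.card_product, Finset.card_product, Finset.card_univ, Int.card_Icc]
      simp only [Fintype.card_prod]
      have e1 : ((W : ℤ) + 1 - -W).toNat = 2 * W + 1 := by omega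
      rw [e1]
      calc _ = lo + 2 * (Fintype.card S ^ 4 * (2 * W + 1) ^ 2) := by ring
        _ < hi := hlev)
  simp only [Prod.mk.injEq] at ht1 ht2
  have ht3 := And.intro (ht1.1.1.trans ht2.1.1) <| And.intro (ht1.1.2.1.trans ht2.1.2.1) <|
    And.intro (ht1.1.2.2.1.trans ht2.1.2.2.1) <| And.intro (ht1.1.2.2.2.trans ht2.1.2.2.2) <|
    And.intro (ht1.2.1.trans ht2.2.1) (ht1.2.2.trans ht2.2.2)
  have hlt : ∀ p q, lo ≤ p → p < q → q < hi → U p < U q ∧ D q < D p ∧ U q ≤ D q := by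
    intro p q hp hpq hq
    obtain ⟨u1, u2, u3, u4⟩ := hU p (by omega) (by omega)
    obtain ⟨v1, v2, v3, v4⟩ := hU q (by omega) (by omega)
    obtain ⟨d1, d2, d3, d4⟩ := hD p (by omega) (by omega)
    obtain ⟨f1, f2, f3, f4⟩ := hD q (by omega) (by omega)
    refine ⟨?_, ?_, by omega⟩
    · by_contra hc
      rcases (not_lt.1 hc).eq_or_lt with h1 | h1
      · rw [h1] at v3; omega
      · have := v4 _ h1 u2; omega
    · by_contra hc
      rcases (not_lt.1 hc).eq_or_lt with h1 | h1
      · rw [h1] at d3; omega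
      · have := f4 _ d1 h1; omega
  have hval : ∀ p q, lo ≤ p → p ≤ q → q < hi →
      (M.run c (w.take (U p))).state = (M.run c (w.take (U q))).state →
      (M.run d (w.take (U p))).state = (M.run d (w.take (U q))).state →
      (M.run c (w.take (D p))).state = (M.run c (w.take (D q))).state →
      (M.run d (w.take (D p))).state = (M.run d (w.take (D q))).state →
      (x : ℤ) * (M.run c (w.take (U p))).counter - y * (M.run d (w.take (U p))).counter =
        (x : ℤ) * (M.run c (w.take (U q))).counter - y * (M.run d (w.take (U q))).counter →
      (x : ℤ) * (M.run c (w.take (D p))).counter - y * (M.run d (w.take (D p))).counter =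
        (x : ℤ) * (M.run c (w.take (D q))).counter - y * (M.run d (w.take (D q))).counter →
      M.behaviour c (w.take (U p) ++ (factor w (U q) (D q) ++ w.drop (D p))) =
        (M.run c (w.take (U p))).weight * M.behaviour ⟨(M.run c (w.take (D p))).state,
          (M.run c (w.take (D p))).counter, 1⟩ (w.drop (D p)) *
        M.posWeight (M.run c (w.take (U q))).state (factor w (U q) (D q)) ∧
      M.behaviour d (w.take (U p) ++ (factor w (U q) (D q) ++ w.drop (D p))) =
        (M.run d (w.take (U p))).weight * M.behaviour ⟨(M.run d (w.take (D p))).state,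
          (M.run d (w.take (D p))).counter, 1⟩ (w.drop (D p)) *
        M.posWeight (M.run d (w.take (U q))).state (factor w (U q) (D q)) := by
    intro p q hp hpq hq s1 s2 s3 s4 b1 b2
    obtain ⟨u1, u2, u3, u4⟩ := hU p (by omega) (by omega)
    obtain ⟨v1, v2, v3, v4⟩ := hU q (by omega) (by omega)
    obtain ⟨d1, d2, d3, d4⟩ := hD p (by omega) (by omega)
    obtain ⟨f1, f2, f3, f4⟩ := hD q (by omega) (by omega)
    have hhigh : ∀ k, U q ≤ k → k ≤ D q → q ≤ (M.run c (w.take k)).counter := by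
      intro k hk1 hk2
      rcases hk1.eq_or_lt with h1 | h1
      · rw [← h1, v3]
      rcases hk2.eq_or_lt with h2 | h2
      · rw [h2, f3]
      rcases le_total k i with h3 | h3
      · exact (v4 k h1 h3).le
      · exact (f4 k h3 h2).le
    rw [u3, v3] at b1
    rw [d3, f3] at b2
    obtain ⟨n1, -, n3, n4⟩ := belt_shift (W := W) hx hy hpq b1
    obtain ⟨n1', -, n3', -⟩ := belt_shift (W := W) hx hy hpq b2
    have hy0 : (y : ℤ) ≠ 0 := by exact_mod_cast (by omega)
    -- The second run is lowered by the same amount at both crossings, so the cut words fit together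
    -- for it as well.
    have n5 := mul_left_cancel₀ hy0 (n3.trans n3'.symm)
    refine ⟨M.behaviour_cut (r := q - p) (by omega) (by omega) s1 (by omega) s3 (by omega)
      fun k hk1 hk2 => ?_, M.behaviour_cut
      (r := (M.run d (w.take (U q))).counter - (M.run d (w.take (U p))).counter)
      (by omega) (by omega) s2 (by omega) s4 (by omega) fun k hk1 hk2 => ?_⟩
    · have := hhigh k hk1 hk2
      omega
    · have h1 := n4 _ _ (hhigh k hk1 hk2) (hbelt k (by omega) (by omega))
      have h2 : 0 < (y : ℤ) * ((M.run d (w.take k)).counter -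
          ((M.run d (w.take (U q))).counter - (M.run d (w.take (U p))).counter)) := by omega
      have h3 := pos_of_mul_pos_right h2 (by positivity)
      omega
  have hwhole : ∀ p, lo ≤ p → p < hi →
      w.take (U p) ++ (factor w (U p) (D p) ++ w.drop (D p)) = w := by
    intro p hp hq
    obtain ⟨u1, u2, -, -⟩ := hU p (by omega) (by omega)
    obtain ⟨d1, d2, -, -⟩ := hD p (by omega) (by omega)
    rw [← List.append_assoc, take_append_factor w (by omega), List.take_append_drop]
  have hshort : ∀ p q, lo ≤ p → p < q → q < hi →
      M.behaviour c (w.take (U p) ++ (factor w (U q) (D q) ++ w.drop (D p))) =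
      M.behaviour d (w.take (U p) ++ (factor w (U q) (D q) ++ w.drop (D p))) := by
    intro p q hp hpq hq
    obtain ⟨h1, h2, h3⟩ := hlt p q hp hpq hq
    obtain ⟨d1, d2, -, -⟩ := hD p (by omega) (by omega)
    apply h.eq_of_length_lt
    rw [List.length_append, List.length_append, List.length_take, List.length_drop,
      length_factor w (by omega)]
    omega
  have hne : ∀ p, lo ≤ p → p < hi →
      (M.run c (w.take (U p))).weight * M.behaviour ⟨(M.run c (w.take (D p))).state,
          (M.run c (w.take (D p))).counter, 1⟩ (w.drop (D p)) *
        M.posWeight (M.run c (w.take (U p))).state (factor w (U p) (D p)) ≠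
      (M.run d (w.take (U p))).weight * M.behaviour ⟨(M.run d (w.take (D p))).state,
          (M.run d (w.take (D p))).counter, 1⟩ (w.drop (D p)) *
        M.posWeight (M.run d (w.take (U p))).state (factor w (U p) (D p)) := by
    intro p hp hq
    obtain ⟨h1, h2⟩ := hval p p hp le_rfl hq rfl rfl rfl rfl rfl rfl
    rw [← h1, ← h2, hwhole p hp hq]
    exact h.ne
  have hcut : ∀ p q, lo ≤ p → p < q → q < hi →
      (M.run c (w.take (U p))).state = (M.run c (w.take (U q))).state →
      (M.run d (w.take (U p))).state = (M.run d (w.take (U q))).state →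
      (M.run c (w.take (D p))).state = (M.run c (w.take (D q))).state →
      (M.run d (w.take (D p))).state = (M.run d (w.take (D q))).state →
      (x : ℤ) * (M.run c (w.take (U p))).counter - y * (M.run d (w.take (U p))).counter =
        (x : ℤ) * (M.run c (w.take (U q))).counter - y * (M.run d (w.take (U q))).counter →
      (x : ℤ) * (M.run c (w.take (D p))).counter - y * (M.run d (w.take (D p))).counter =
        (x : ℤ) * (M.run c (w.take (D q))).counter - y * (M.run d (w.take (D q))).counter →
      (M.run c (w.take (U p))).weight * M.behaviour ⟨(M.run c (w.take (D p))).state,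
          (M.run c (w.take (D p))).counter, 1⟩ (w.drop (D p)) *
        M.posWeight (M.run c (w.take (U q))).state (factor w (U q) (D q)) =
      (M.run d (w.take (U p))).weight * M.behaviour ⟨(M.run d (w.take (D p))).state,
          (M.run d (w.take (D p))).counter, 1⟩ (w.drop (D p)) *
        M.posWeight (M.run d (w.take (U q))).state (factor w (U q) (D q)) := by
    intro p q hp hpq hq s1 s2 s3 s4 b1 b2
    obtain ⟨h1, h2⟩ := hval p q hp hpq.le hq s1 s2 s3 s4 b1 b2
    rw [← h1, ← h2]
    exact hshort p q hp hpq hq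
  have hall : ∀ j, lo ≤ (![p1, p2, p3] : Fin 3 → ℕ) j ∧ (![p1, p2, p3] : Fin 3 → ℕ) j < hi := by
    intro j
    fin_cases j
    · exact ⟨hp1, by change p1 < hi; omega⟩
    · exact ⟨by change lo ≤ p2; omega, by change p2 < hi; omega⟩
    · exact ⟨by change lo ≤ p3; omega, hp3⟩
  -- For levels `p ≤ q` the outer parts come from `p` and the middle from `q`; the value factors
  -- into an outer term and the weight of the middle.
  exact false_of_triangular
    (f := fun j => (M.run c (w.take (U (![p1, p2, p3] j)))).weight *
      M.behaviour ⟨(M.run c (w.take (D (![p1, p2, p3] j)))).state,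
        (M.run c (w.take (D (![p1, p2, p3] j)))).counter, 1⟩ (w.drop (D (![p1, p2, p3] j))))
    (f' := fun j => (M.run d (w.take (U (![p1, p2, p3] j)))).weight *
      M.behaviour ⟨(M.run d (w.take (D (![p1, p2, p3] j)))).state,
        (M.run d (w.take (D (![p1, p2, p3] j)))).counter, 1⟩ (w.drop (D (![p1, p2, p3] j))))
    (b := fun j => M.posWeight (M.run c (w.take (U (![p1, p2, p3] j)))).state
      (factor w (U (![p1, p2, p3] j)) (D (![p1, p2, p3] j))))
    (b' := fun j => M.posWeight (M.run d (w.take (U (![p1, p2, p3] j)))).state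
      (factor w (U (![p1, p2, p3] j)) (D (![p1, p2, p3] j))))
    (fun j => hne _ (hall j).1 (hall j).2)
    (hcut p1 p2 hp1 hp12 (by omega) ht1.1.1 ht1.1.2.1 ht1.1.2.2.1 ht1.1.2.2.2 ht1.2.1 ht1.2.2)
    (hcut p1 p3 hp1 (by omega) hp3 ht3.1 ht3.2.1 ht3.2.2.1 ht3.2.2.2.1 ht3.2.2.2.2.1
      ht3.2.2.2.2.2)
    (hcut p2 p3 (by omega) hp23 hp3 ht2.1.1 ht2.1.2.1 ht2.1.2.2.1 ht2.1.2.2.2 ht2.2.1 ht2.2.2)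

/-- A minimal witness does not end high up after a long climb inside a belt. -/
theorem MinimalWitness.false_of_climb {c d : Config S F} {w : List α}
    (h : M.MinimalWitness c d w) {a i e lo hi x y W ρ : ℕ} (hai : a ≤ i) (hie : i ≤ e)
    (he : e ≤ w.length) (hρ : w.length ≤ e + ρ) (hx : 1 ≤ x) (hy : 1 ≤ y)
    (hbelt : ∀ k, a ≤ k → k ≤ e →
      |(x : ℤ) * (M.run c (w.take k)).counter - y * (M.run d (w.take k)).counter| ≤ W)
    (hW : W + y * ρ < lo) (ha : (M.run c (w.take a)).counter ≤ lo)
    (hhi : ∀ k, i ≤ k → k ≤ e → hi ≤ (M.run c (w.take k)).counter)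
    (hlev : lo + 2 * (Fintype.card S ^ 2 * (2 * W + 1)) < hi) : False := by
  have hii := hhi i le_rfl hie
  have hρlo : ρ < lo := by
    have : ρ ≤ y * ρ := Nat.le_mul_of_pos_left ρ hy
    omega
  obtain ⟨U, hU⟩ := exists_last_times (f := fun k => (M.run c (w.take k)).counter)
    (fun k => (M.counter_take_succ c w k).1) hai
  obtain ⟨p1, p2, p3, hp1, hp12, hp23, hp3, ht1, ht2⟩ := exists_three_eq (a := lo) (b := hi)
    ((Finset.univ : Finset (S × S)) ×ˢ Finset.Icc (-W : ℤ) W)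
    (fun z => (((M.run c (w.take (U z))).state, (M.run d (w.take (U z))).state),
      (x : ℤ) * (M.run c (w.take (U z))).counter - y * (M.run d (w.take (U z))).counter))
    (fun z hz1 hz2 => by
      obtain ⟨u1, u2, -, -⟩ := hU z (by omega) (by omega)
      simp only [Finset.mem_product, Finset.mem_univ, true_and, Finset.mem_Icc, ← abs_le]
      exact hbelt _ u1 (by omega))
    (by
      rw [Finset.card_product, Finset.card_univ, Int.card_Icc]
      simp only [Fintype.card_prod]
      have e1 : ((W : ℤ) + 1 - -W).toNat = 2 * W + 1 := by omega
      rw [e1, ← sq]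
      exact hlev)
  simp only [Prod.mk.injEq] at ht1 ht2
  have hhigh : ∀ q, lo ≤ q → q < hi → ∀ k, U q ≤ k → k ≤ e →
      q ≤ (M.run c (w.take k)).counter := by
    intro q hp hq k hk1 hk2
    obtain ⟨v1, v2, v3, v4⟩ := hU q (by omega) (by omega)
    rcases hk1.eq_or_lt with h1 | h1
    · rw [← h1, v3]
    rcases le_total k i with h3 | h3
    · exact (v4 k h1 h3).le
    · exact hq.le.trans (hhi k h3 hk2)
  have hlt : ∀ p q, lo ≤ p → p < q → q < hi → U p < U q := by
    intro p q hp hpq hq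
    obtain ⟨u1, u2, u3, u4⟩ := hU p (by omega) (by omega)
    have := hhigh q (by omega) hq
    by_contra hc
    have := this (U p) (by omega) (by omega)
    omega
  have hval : ∀ p q, lo ≤ p → p ≤ q → q < hi →
      (M.run c (w.take (U p))).state = (M.run c (w.take (U q))).state →
      (M.run d (w.take (U p))).state = (M.run d (w.take (U q))).state →
      (x : ℤ) * (M.run c (w.take (U p))).counter - y * (M.run d (w.take (U p))).counter =
        (x : ℤ) * (M.run c (w.take (U q))).counter - y * (M.run d (w.take (U q))).counter →
      M.behaviour c (w.take (U p) ++ factor w (U q) w.length) =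
        (M.run c (w.take (U p))).weight * M.final (M.run c w).state *
        M.posWeight (M.run c (w.take (U q))).state (factor w (U q) w.length) ∧
      M.behaviour d (w.take (U p) ++ factor w (U q) w.length) =
        (M.run d (w.take (U p))).weight * M.final (M.run d w).state *
        M.posWeight (M.run d (w.take (U q))).state (factor w (U q) w.length) := by
    intro p q hp hpq hq s1 s2 b1
    obtain ⟨u1, u2, u3, u4⟩ := hU p (by omega) (by omega)
    obtain ⟨v1, v2, v3, v4⟩ := hU q (by omega) (by omega)
    rw [u3, v3] at b1
    obtain ⟨n1, -, n3, n4⟩ := belt_shift (W := W) hx hy hpq b1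
    -- After time `e` there is no belt, but at most `ρ` letters remain; the term `y * ρ` in `hW` is
    -- the reserve for them.
    have htail : ∀ (c : Config S F) k, e ≤ k → k ≤ w.length →
        (M.run c (w.take e)).counter ≤ (M.run c (w.take k)).counter + ρ := by
      intro c k hk1 hk2
      have h1 := M.counter_run_le (M.run c (w.take e)) (factor w e k)
      rw [run_take_factor M c w hk1, length_factor w hk2] at h1
      omega
    refine ⟨M.behaviour_cut_suffix (r := q - p) (by omega) s1 (by omega)
      fun k hk1 hk2 => ?_, M.behaviour_cut_suffix
      (r := (M.run d (w.take (U q))).counter - (M.run d (w.take (U p))).counter)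
      (by omega) s2 (by omega) fun k hk1 hk2 => ?_⟩
    · rcases le_total k e with h1 | h1
      · have := hhigh q (by omega) hq k hk1 h1
        omega
      · have := hhigh q (by omega) hq e (by omega) le_rfl
        have := htail c k h1 hk2
        omega
    · have h4 : ∀ k, U q ≤ k → k ≤ e → ρ + ((M.run d (w.take (U q))).counter -
          (M.run d (w.take (U p))).counter) < (M.run d (w.take k)).counter := by
        intro k hk1 hk2
        have h1 := n4 _ _ (hhigh q (by omega) hq k hk1 hk2) (hbelt k (by omega) (by omega))
        have hW' : (W : ℤ) + y * ρ < lo := by exact_mod_cast hW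
        have h2 : (y : ℤ) * ρ < (y : ℤ) * ((M.run d (w.take k)).counter -
          ((M.run d (w.take (U q))).counter - (M.run d (w.take (U p))).counter)) := by omega
        have h3 := lt_of_mul_lt_mul_left h2 (by positivity)
        omega
      rcases le_total k e with h1 | h1
      · have := h4 k hk1 h1
        omega
      · have := h4 e (by omega) le_rfl
        have := htail d k h1 hk2
        omega
  have hshort : ∀ p q, lo ≤ p → p < q → q < hi →
      M.behaviour c (w.take (U p) ++ factor w (U q) w.length) =
      M.behaviour d (w.take (U p) ++ factor w (U q) w.length) := by
    intro p q hp hpq hq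
    have h1 := hlt p q hp hpq hq
    obtain ⟨d1, d2, -, -⟩ := hU q (by omega) (by omega)
    apply h.eq_of_length_lt
    rw [List.length_append, List.length_take, length_factor w le_rfl]
    omega
  have hne : ∀ p, lo ≤ p → p < hi →
      (M.run c (w.take (U p))).weight * M.final (M.run c w).state *
        M.posWeight (M.run c (w.take (U p))).state (factor w (U p) w.length) ≠
      (M.run d (w.take (U p))).weight * M.final (M.run d w).state *
        M.posWeight (M.run d (w.take (U p))).state (factor w (U p) w.length) := by
    intro p hp hq
    obtain ⟨d1, d2, -, -⟩ := hU p (by omega) (by omega)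
    obtain ⟨h1, h2⟩ := hval p p hp le_rfl hq rfl rfl rfl
    rw [← h1, ← h2, take_append_factor w (by omega), List.take_length]
    exact h.ne
  have hcut : ∀ p q, lo ≤ p → p < q → q < hi →
      (M.run c (w.take (U p))).state = (M.run c (w.take (U q))).state →
      (M.run d (w.take (U p))).state = (M.run d (w.take (U q))).state →
      (x : ℤ) * (M.run c (w.take (U p))).counter - y * (M.run d (w.take (U p))).counter =
        (x : ℤ) * (M.run c (w.take (U q))).counter - y * (M.run d (w.take (U q))).counter →
      (M.run c (w.take (U p))).weight * M.final (M.run c w).state *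
        M.posWeight (M.run c (w.take (U q))).state (factor w (U q) w.length) =
      (M.run d (w.take (U p))).weight * M.final (M.run d w).state *
        M.posWeight (M.run d (w.take (U q))).state (factor w (U q) w.length) := by
    intro p q hp hpq hq s1 s2 b1
    obtain ⟨h1, h2⟩ := hval p q hp hpq.le hq s1 s2 b1
    rw [← h1, ← h2]
    exact hshort p q hp hpq hq
  have hall : ∀ j, lo ≤ (![p1, p2, p3] : Fin 3 → ℕ) j ∧ (![p1, p2, p3] : Fin 3 → ℕ) j < hi := by
    intro j
    fin_cases j
    · exact ⟨hp1, by change p1 < hi; omega⟩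
    · exact ⟨by change lo ≤ p2; omega, by change p2 < hi; omega⟩
    · exact ⟨by change lo ≤ p3; omega, hp3⟩
  exact false_of_triangular
    (f := fun j => (M.run c (w.take (U (![p1, p2, p3] j)))).weight * M.final (M.run c w).state)
    (f' := fun j => (M.run d (w.take (U (![p1, p2, p3] j)))).weight * M.final (M.run d w).state)
    (b := fun j => M.posWeight (M.run c (w.take (U (![p1, p2, p3] j)))).state
      (factor w (U (![p1, p2, p3] j)) w.length))
    (b' := fun j => M.posWeight (M.run d (w.take (U (![p1, p2, p3] j)))).state
      (factor w (U (![p1, p2, p3] j)) w.length))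
    (fun j => hne _ (hall j).1 (hall j).2)
    (hcut p1 p2 hp1 hp12 (by omega) ht1.1.1 ht1.1.2 ht1.2)
    (hcut p1 p3 hp1 (by omega) hp3 (ht1.1.1.trans ht2.1.1) (ht1.1.2.trans ht2.1.2)
      (ht1.2.trans ht2.2))
    (hcut p2 p3 (by omega) hp23 hp3 ht2.1.1 ht2.1.2 ht2.2)

/-- After a long climb inside a belt, the pair of configurations that is reached can be reached
by a shorter word with smaller counters in the same proportion. -/
theorem exists_translate {c d : Config S F} {w : List α} {a i e lo hi x y W G B : ℕ} (hai : a ≤ i)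
    (hie : i ≤ e) (he : e + 1 ≤ w.length) (hx : 1 ≤ x) (hy : 1 ≤ y) (hB : 1 ≤ B) (hG : 1 ≤ G)
    (hbelt : ∀ k, a ≤ k → k ≤ e →
      |(x : ℤ) * (M.run c (w.take k)).counter - y * (M.run d (w.take k)).counter| ≤ W)
    (hwc : ∀ k, a ≤ k → k ≤ e → (M.run c (w.take k)).weight ≠ 0)
    (hwd : ∀ k, a ≤ k → k ≤ e → (M.run d (w.take k)).weight ≠ 0)
    (hW : W + y * (G + 1) ≤ lo) (ha : (M.run c (w.take a)).counter ≤ lo)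
    (hhi : ∀ k, i ≤ k → k ≤ e → hi ≤ (M.run c (w.take k)).counter)
    (hlev : lo + Fintype.card S ^ 2 * (2 * W + 1) * B ^ 2 < hi) :
    M.Translates c d w (e + 1) x y G B := by
  have hii := hhi i le_rfl hie
  have hGlo : G + 1 ≤ lo := by
    have : G + 1 ≤ y * (G + 1) := Nat.le_mul_of_pos_left _ hy
    omega
  obtain ⟨U, hU⟩ := exists_last_times (f := fun k => (M.run c (w.take k)).counter)
    (fun k => (M.counter_take_succ c w k).1) hai
  -- Besides states and offset, both counters modulo `B` are recorded, which makes the translation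
  -- divisible by `B`.
  obtain ⟨p, q, hp, hpq, hq, ht⟩ := exists_two_eq (a := lo) (b := hi)
    (((Finset.univ : Finset (S × S)) ×ˢ Finset.Icc (-W : ℤ) W) ×ˢ
      (Finset.range B ×ˢ Finset.range B))
    (fun z => ((((M.run c (w.take (U z))).state, (M.run d (w.take (U z))).state),
      (x : ℤ) * (M.run c (w.take (U z))).counter - y * (M.run d (w.take (U z))).counter),
      (M.run c (w.take (U z))).counter % B, (M.run d (w.take (U z))).counter % B))
    (fun z hz1 hz2 => by
      obtain ⟨u1, u2, -, -⟩ := hU z (by omega) (by omega)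
      simp only [Finset.mem_product, Finset.mem_univ, true_and, Finset.mem_Icc, ← abs_le,
        Finset.mem_range]
      exact ⟨hbelt _ u1 (by omega), Nat.mod_lt _ hB, Nat.mod_lt _ hB⟩)
    (by
      rw [Finset.card_product, Finset.card_product, Finset.card_product, Finset.card_univ,
        Int.card_Icc, Finset.card_range]
      simp only [Fintype.card_prod]
      have e1 : ((W : ℤ) + 1 - -W).toNat = 2 * W + 1 := by omega
      rw [e1, ← sq, ← sq]
      exact hlev)
  simp only [Prod.mk.injEq] at ht
  obtain ⟨⟨⟨s1, s2⟩, b1⟩, b2, b3⟩ := ht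
  obtain ⟨u1, u2, u3, u4⟩ := hU p (by omega) (by omega)
  obtain ⟨v1, v2, v3, v4⟩ := hU q (by omega) (by omega)
  have hhigh : ∀ k, U q ≤ k → k ≤ e → q ≤ (M.run c (w.take k)).counter := by
    intro k hk1 hk2
    rcases hk1.eq_or_lt with h1 | h1
    · rw [← h1, v3]
    rcases le_total k i with h3 | h3
    · exact (v4 k h1 h3).le
    · exact hq.le.trans (hhi k h3 hk2)
  have hUlt : U p < U q := by
    by_contra hc
    have := hhigh (U p) (by omega) (by omega)
    omega
  rw [u3, v3] at b1 b2
  obtain ⟨n1, n2, n3, n4⟩ := belt_shift (W := W) hx hy hpq.le b1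
  have n2 := n2 hpq
  set n := (M.run d (w.take (U p))).counter with hn
  set n' := (M.run d (w.take (U q))).counter with hn'
  have hr : ∀ k, U q ≤ k → k ≤ e → G + 1 + (q - p) ≤ (M.run c (w.take k)).counter ∧
      G + 1 + (n' - n) ≤ (M.run d (w.take k)).counter := by
    intro k hk1 hk2
    have h0 := hhigh k hk1 hk2
    refine ⟨by omega, ?_⟩
    have h1 := n4 _ _ h0 (hbelt k (by omega) hk2)
    have hW' : (W : ℤ) + y * ((G : ℤ) + 1) ≤ lo := by exact_mod_cast hW
    have h2 : (y : ℤ) * ((G : ℤ) + 1) ≤ (y : ℤ) * ((M.run d (w.take k)).counter - (n' - n)) := by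
      omega
    have h3 := le_of_mul_le_mul_left h2 (by exact_mod_cast hy)
    omega
  -- The spare unit in `G + 1` pays for the letter after `e`, where the belt is not assumed.
  have hr' : ∀ k, U q ≤ k → k ≤ e + 1 → G + (q - p) ≤ (M.run c (w.take k)).counter ∧
      G + (n' - n) ≤ (M.run d (w.take k)).counter := by
    intro k hk1 hk2
    rcases hk2.eq_or_lt with h1 | h1
    · have h2 := hr e (by omega) le_rfl
      have h3 := (M.counter_take_succ c w e).2
      have h4 := (M.counter_take_succ d w e).2
      rw [h1]
      omega
    · have := hr k hk1 (by omega)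
      omega
  have key : ∀ (c : Config S F) (r : ℕ),
      (M.run c (w.take (U p))).state = (M.run c (w.take (U q))).state →
      (M.run c (w.take (U p))).counter + r = (M.run c (w.take (U q))).counter →
      (M.run c (w.take (U p))).weight ≠ 0 → (M.run c (w.take (U q))).weight ≠ 0 →
      (∀ k, U q ≤ k → k ≤ e + 1 → r < (M.run c (w.take k)).counter) →
      ∃ s, M.run c (w.take (U p) ++ factor w (U q) (e + 1)) =
        ⟨(M.run c (w.take (e + 1))).state, (M.run c (w.take (e + 1))).counter - r, s⟩ ∧
        (s = 0 ↔ (M.run c (w.take (e + 1))).weight = 0) := by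
    intro c r hs hc hw1 hw2 H
    have h1 := M.run_translate (i := U q) (by omega) he H (M.run c (w.take (U p))).weight
    -- The unshifted reading has the same factor weight, so the final weights of both words vanish
    -- together.
    have h2 := M.run_translate (c := c) (i := U q) (r := 0) (by omega) he
      (fun k hk1 hk2 => by have := H k hk1 hk2; omega) (M.run c (w.take (U q))).weight
    rw [← hs, ← hc, Nat.add_sub_cancel] at h1
    have h3 : (M.run c (w.take (e + 1))).weight = _ := congrArg Config.weight
      ((M.run_take_factor c w (show U q ≤ e + 1 by omega)).symm.trans h2)
    refine ⟨_, by rw [run_append]; exact h1, ?_⟩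
    rw [h3, hs]
    simp only [mul_eq_zero, hw1, hw2, false_or]
  obtain ⟨s, hs, hs0⟩ := key c (q - p) s1 (by omega) (hwc _ u1 (by omega)) (hwc _ v1 (by omega))
    fun k hk1 hk2 => by have := (hr' k hk1 hk2).1; omega
  obtain ⟨t, ht, ht0⟩ := key d (n' - n) s2 (by omega) (hwd _ u1 (by omega)) (hwd _ v1 (by omega))
    fun k hk1 hk2 => by have := (hr' k hk1 hk2).2; omega
  refine ⟨q - p, n' - n, w.take (U p) ++ factor w (U q) (e + 1), s, t, by omega, by omega,
    (Nat.modEq_iff_dvd' hpq.le).1 b2, (Nat.modEq_iff_dvd' n1).1 b3, ?_,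
    (hr' _ (by omega) le_rfl).1, (hr' _ (by omega) le_rfl).2, ?_, hs, ht, hs0, ht0⟩
  · zify [hpq.le, n1]
    exact n3.symm
  · rw [List.length_append, List.length_take, length_factor w he]
    omega

end Excursions
end DWROCA

namespace DWROCA

/-! ### The counter bound while distances are equal -/

section Heights

variable {S α F : Type*} [Field F] [Fintype S] {M : DWROCA S α F}

/-- After `N` letters of `w` the second configuration is further from the special configurations
than the first one, and the rest of `w` has the length that this allows. -/
def FarTail (M : DWROCA S α F) (c d : Config S F) (w : List α) (N : ℕ) : Prop :=
  ∃ δ, M.HasDist (M.run c (w.take N)) δ ∧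
    (∀ u, M.Special (M.run (M.run d (w.take N)) u) → δ < u.length) ∧ w.length = N + δ + depth S

/-- This supplies `false_of_translate` with the length of the shorter word as `N'`; that word
followed by any distinguishing word is at least as long as `w`. -/
theorem MinimalWitness.false_of_farTail {c d : Config S F} {w : List α}
    (h : M.MinimalWitness c d w) {N x y : ℕ} (ht : M.FarTail c d w N) (hxy : Nat.Coprime x y)
    (hx : 1 ≤ x) (hxK : x ≤ Fintype.card S ^ 2) (hy : 1 ≤ y) (hyK : y ≤ Fintype.card S ^ 2)
    (hbelt : |(x : ℤ) * (M.run c (w.take N)).counter - y * (M.run d (w.take N)).counter| ≤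
      22 * (Fintype.card S : ℤ) ^ 5 + 2 * (Fintype.card S : ℤ) ^ 2)
    (htr : ∀ B, 1 ≤ B → B ≤ Fintype.card S ^ 2 →
      M.Translates c d w N x y (100 * Fintype.card S ^ 7) B) : False := by
  obtain ⟨δ, hδ, hfar, hlen⟩ := ht
  refine false_of_translate (p := (M.run c (w.take N)).state) (s := (M.run c (w.take N)).weight)
    (q := (M.run d (w.take N)).state) (t := (M.run d (w.take N)).weight)
    (m := (M.run c (w.take N)).counter) (n := (M.run d (w.take N)).counter) hxy hx hxK hy hyK hδ hfar
    hlen hbelt fun B hB1 hB2 => ?_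
  obtain ⟨r, r', z, s, t, h1, h2, h3, h4, h5, h6, h7, h8, h9, h10, h11, h12⟩ := htr B hB1 hB2
  refine ⟨(M.run c (w.take N)).counter - r, (M.run d (w.take N)).counter - r', z.length, s, t,
    ?_, ?_, ?_, ?_, ?_, ?_, h12.2, h8, fun u v huv => ?_⟩
  · omega
  · rw [Nat.cast_sub (by omega), sub_sub_cancel]
    exact_mod_cast h3
  · rw [Nat.cast_sub (by omega), Nat.cast_sub (by omega), sub_sub_cancel, sub_sub_cancel]
    exact_mod_cast h5
  · omega
  · omega
  · exact fun h0 => hδ.weight_ne_zero (h11.1 h0)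
  · rw [← h9, ← h10, ← run_append, ← run_append, ← behaviour_append, ← behaviour_append] at huv
    have := h.min _ huv
    rwa [List.length_append, List.length_append] at this

/-- As long as the two runs are at equal distances, the counter stays small. -/
theorem MinimalWitness.counter_le {c d : Config S F} {w : List α} (h : M.MinimalWitness c d w)
    (hc : c.counter = 0) {N : ℕ} (hNw : N ≤ w.length + 1)
    (hN : ∀ i < N, M.SameDist (M.run c (w.take i)) (M.run d (w.take i)))
    (htail : w.length ≤ N + depth S ∨ M.FarTail c d w N ∨ M.FarTail d c w N) {i : ℕ} (hi : i < N) :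
    (M.run c (w.take i)).counter ≤ 4400 * Fintype.card S ^ 14 := by
  have hKpos : 0 < Fintype.card S := Fintype.card_pos_iff.2 ⟨c.state⟩
  have hdep : depth S = 2 * Fintype.card S ^ 2 := rfl
  set K := Fintype.card S with hK
  have kp : ∀ {m n : ℕ}, m ≤ n → K ^ m ≤ K ^ n := fun hmn => Nat.pow_le_pow_right hKpos hmn
  have k1 : 1 ≤ K ^ 2 := Nat.one_le_pow _ _ hKpos
  have k2 : K ^ 2 ≤ K ^ 4 := kp (by norm_num)
  have k4 : K ^ 4 ≤ K ^ 5 := kp (by norm_num)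
  have k5 : K ^ 5 ≤ K ^ 7 := kp (by norm_num)
  have k7 : K ^ 7 ≤ K ^ 9 := kp (by norm_num)
  have k9 : K ^ 9 ≤ K ^ 11 := kp (by norm_num)
  have k11 : K ^ 11 ≤ K ^ 14 := kp (by norm_num)
  have e1 : K ^ 4 * (2 * (22 * K ^ 5) + 1) ^ 2 = 1936 * K ^ 14 + 88 * K ^ 9 + K ^ 4 := by ring
  have e2 : K ^ 2 * (2 * (22 * K ^ 5) + 1) = 44 * K ^ 7 + K ^ 2 := by ring
  by_contra! hcon
  -- From `a` up to `i` the counter exceeds `50K⁷`, which is what `exists_belt_along` needs.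
  obtain ⟨a, -, ha1, ha2, ha3⟩ := exists_last_eq (f := fun k => (M.run c (w.take k)).counter)
    (x := 50 * K ^ 7 + 1) (Nat.zero_le i) (fun k _ _ => (M.counter_take_succ c w k).1)
    (by simp [hc]) (by omega)
  have hbelts : ∀ e, i ≤ e → e < N → (∀ k, i ≤ k → k ≤ e →
      300 * K ^ 11 ≤ (M.run c (w.take k)).counter) →
      ∃ x y : ℕ, Nat.Coprime x y ∧ 1 ≤ x ∧ x ≤ K ^ 2 ∧ 1 ≤ y ∧
      y ≤ K ^ 2 ∧ ∀ k, a ≤ k → k ≤ e →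
      |(x : ℤ) * (M.run c (w.take k)).counter - y * (M.run d (w.take k)).counter| ≤
        ((22 * K ^ 5 : ℕ) : ℤ) := by
    intro e hie heN hhigh
    obtain ⟨x, y, h1, h2, h3, h4, h5, h6⟩ := exists_belt_along (M := M) (c := c) (d := d) (w := w)
      (a := a) (e := e) (by omega) (fun k _ hk => hN k (by omega)) (fun k hk1 hk2 => by
        rw [← hK]
        rcases hk1.eq_or_lt with h1 | h1
        · rw [← h1]; omega
        rcases le_total k i with h2 | h2
        · have := ha3 k h1 h2
          omega
        · have := hhigh k h2 hk2
          omega)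
    exact ⟨x, y, h1, h2, h3, h4, h5, fun k hk1 hk2 => by push_cast; exact h6 k hk1 hk2⟩
  -- A run that comes down again is an excursion. Otherwise it stays high until `N`, and the end of
  -- `w` decides.
  by_cases hret : ∃ k, i ≤ k ∧ k < N ∧ (M.run c (w.take k)).counter ≤ 300 * K ^ 11
  · obtain ⟨k, hk1, hk2, hk3⟩ := hret
    obtain ⟨e, he1, he2, he3, he4⟩ := exists_first_eq
      (f := fun k => (M.run c (w.take k)).counter) (x := 300 * K ^ 11) hk1
      (fun k _ _ => (M.counter_take_succ c w k).2) (by omega) hk3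
    obtain ⟨x, y, -, hx, -, hy, -, hb⟩ := hbelts e he1 (by omega) fun k h1 h2 => by
      rcases h2.eq_or_lt with h3 | h3
      · rw [h3]; exact he3.ge
      · exact (he4 k h1 h3).le
    refine h.false_of_return (lo := 300 * K ^ 11) (hi := 4400 * K ^ 14) ha1 he1 (by omega) hx hy hb
      (by omega) (by omega) he3.le hcon.le ?_
    rw [← hK, e1]
    omega
  · push Not at hret
    have hhigh : ∀ k, i ≤ k → k ≤ N - 1 → 300 * K ^ 11 ≤ (M.run c (w.take k)).counter :=
      fun k h1 h2 => (hret k h1 (by omega)).le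
    obtain ⟨x, y, hxy, hx, hxK, hy, hyK, hb⟩ := hbelts (N - 1) (by omega) (by omega) hhigh
    rcases htail with htail | htail
    · have e3 : y * (depth S + 1) ≤ 2 * K ^ 4 + K ^ 2 := by
        calc _ ≤ K ^ 2 * (2 * K ^ 2 + 1) := Nat.mul_le_mul hyK (by omega)
          _ = _ := by ring
      refine h.false_of_climb (e := N - 1) (ρ := depth S + 1) (lo := 150 * K ^ 9)
        (hi := 300 * K ^ 11) ha1 (by omega) (by omega) (by omega) hx hy hb (by omega) (by omega)
        hhigh ?_
      rw [← hK, e2]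
      omega
    · have hNlen : N ≤ w.length := by
        rcases htail with ⟨δ, -, -, hl⟩ | ⟨δ, -, -, hl⟩ <;> omega
      have hN1 : N - 1 + 1 = N := by omega
      have htr : ∀ B, 1 ≤ B → B ≤ K ^ 2 → M.Translates c d w N x y (100 * K ^ 7) B := by
        intro B hB1 hB2
        have e3 : y * (100 * K ^ 7 + 1) ≤ 100 * K ^ 9 + K ^ 2 := by
          calc _ ≤ K ^ 2 * (100 * K ^ 7 + 1) := Nat.mul_le_mul hyK le_rfl
            _ = _ := by ring
        have e4 : K ^ 2 * (2 * (22 * K ^ 5) + 1) * B ^ 2 ≤ 44 * K ^ 11 + K ^ 6 := by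
          calc _ ≤ K ^ 2 * (2 * (22 * K ^ 5) + 1) * (K ^ 2) ^ 2 := by gcongr
            _ = _ := by ring
        have k6 : K ^ 6 ≤ K ^ 11 := kp (by norm_num)
        rw [← hN1]
        refine exists_translate (lo := 150 * K ^ 9) (hi := 300 * K ^ 11) ha1 (by omega) (by omega)
          hx hy hB1 (by omega) hb (fun k hk1 hk2 => ?_) (fun k hk1 hk2 => ?_) (by omega) (by omega)
          hhigh ?_
        · obtain ⟨δ, h1, -⟩ := hN k (by omega)
          exact h1.weight_ne_zero
        · obtain ⟨δ, -, h1⟩ := hN k (by omega)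
          exact h1.weight_ne_zero
        · rw [← hK]
          omega
      have hbN : |(x : ℤ) * (M.run c (w.take N)).counter - y * (M.run d (w.take N)).counter| ≤
          22 * (K : ℤ) ^ 5 + 2 * (K : ℤ) ^ 2 := by
        have h0 := hb (N - 1) (by omega) le_rfl
        have s1 := M.counter_take_succ c w (N - 1)
        have s2 := M.counter_take_succ d w (N - 1)
        rw [hN1] at s1 s2
        have i1 : (x : ℤ) ≤ K ^ 2 := by exact_mod_cast hxK
        have i2 : (y : ℤ) ≤ K ^ 2 := by exact_mod_cast hyK
        push_cast at h0
        generalize (M.run c (w.take N)).counter = A at *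
        generalize (M.run d (w.take N)).counter = B at *
        generalize (M.run c (w.take (N - 1))).counter = A' at *
        generalize (M.run d (w.take (N - 1))).counter = B' at *
        have f1 : |(A : ℤ) - A'| ≤ 1 := by rw [abs_le]; omega
        have f2 : |(B : ℤ) - B'| ≤ 1 := by rw [abs_le]; omega
        calc |(x : ℤ) * A - y * B| = |((x : ℤ) * A' - y * B') + (x * ((A : ℤ) - A') - y * ((B : ℤ) - B'))| := by
              congr 1; ring
          _ ≤ |(x : ℤ) * A' - y * B'| + (|(x : ℤ) * ((A : ℤ) - A')| + |(y : ℤ) * ((B : ℤ) - B')|) :=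
              (abs_add_le _ _).trans (add_le_add le_rfl (abs_sub _ _))
          _ ≤ 22 * (K : ℤ) ^ 5 + (K ^ 2 * 1 + K ^ 2 * 1) := by
              rw [abs_mul, abs_mul, Nat.abs_cast, Nat.abs_cast]
              gcongr
          _ = _ := by ring
      rcases htail with ht | ht
      · exact h.false_of_farTail ht hxy hx hxK hy hyK hbN htr
      · rw [abs_sub_comm] at hbN
        exact h.symm.false_of_farTail ht hxy.symm hy hyK hx hxK hbN fun B h1 h2 => (htr B h1 h2).symm

end Heights
end DWROCA

namespace DWROCA

/-! ### The end of a minimal witness and its length -/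

section Length

variable {S α F : Type*} [Field F] {M : DWROCA S α F}

theorem MinimalWitness.length_le_add {c d : Config S F} {w : List α} (h : M.MinimalWitness c d w)
    {N : ℕ} (hN : N ≤ w.length) {v : List α}
    (hv : M.behaviour (M.run c (w.take N)) v ≠ M.behaviour (M.run d (w.take N)) v) :
    w.length ≤ N + v.length := by
  rw [← behaviour_append, ← behaviour_append] at hv
  have := h.min _ hv
  rw [List.length_append, List.length_take] at this
  omega

variable [Fintype S]

/-- If the special configurations are out of reach for some time, then the rest of a minimal
witness is short or longer than this time. -/
theorem MinimalWitness.length_of_far {c d : Config S F} {w : List α} (h : M.MinimalWitness c d w)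
    {N j : ℕ} (hN : N ≤ w.length)
    (hc : ∀ u, M.Special (M.run (M.run c (w.take N)) u) → j < u.length)
    (hd : ∀ u, M.Special (M.run (M.run d (w.take N)) u) → j < u.length)
    (hj : w.length ≤ N + depth S + j) : w.length ≤ N + depth S := by
  obtain ⟨v, hv, hne⟩ := M.exists_short_of_approx (by omega) (M.approx_of_far hc)
    (M.approx_of_far hd) ⟨w.drop N, by rw [List.length_drop]; omega, by
      rw [← behaviour_append, ← behaviour_append, List.take_append_drop]; exact h.ne⟩
  have := h.length_le_add hN hne
  omega

/-- At most `δ + depth` letters remain. If there are fewer, no special configuration is met within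
`δ - 1` letters, so both behaviours are positive ones over the whole rest and differ within `depth`.
-/
theorem MinimalWitness.farTail_of_lt {c d : Config S F} {w : List α} (h : M.MinimalWitness c d w)
    {N δ : ℕ} (hN : N ≤ w.length) (hc : M.HasDist (M.run c (w.take N)) δ)
    (hd : ∀ u, M.Special (M.run (M.run d (w.take N)) u) → δ < u.length) :
    w.length ≤ N + depth S ∨ M.FarTail c d w N := by
  obtain ⟨v, hv, hne⟩ := exists_ne_of_not_hasDist hc
    (d := M.run d (w.take N)) (fun ⟨⟨u, hu, hs⟩, _⟩ => by have := hd u hs; omega)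
  have h1 := h.length_le_add hN hne
  by_cases h2 : w.length = N + δ + depth S
  · exact Or.inr ⟨δ, hc, hd, h2⟩
  · left
    by_cases h3 : δ = 0
    · omega
    · refine h.length_of_far hN (j := δ - 1) (fun u hu => ?_) (fun u hu => ?_) (by omega)
      · have := hc.2 u hu
        omega
      · have := hd u hu
        omega

/-- When the two runs stop being at equal distances, the end of a minimal witness is near, or it
is determined by the smaller distance. -/
theorem MinimalWitness.tail {c d : Config S F} {w : List α} (h : M.MinimalWitness c d w)
    {N : ℕ} (hN : N ≤ w.length) (hne : ¬ M.SameDist (M.run c (w.take N)) (M.run d (w.take N))) :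
    w.length ≤ N + depth S ∨ M.FarTail c d w N ∨ M.FarTail d c w N := by
  by_cases hc : ∃ u, M.Special (M.run (M.run c (w.take N)) u)
  · obtain ⟨δ, hδ⟩ := hasDist_of_special hc
    by_cases hd : ∃ u, M.Special (M.run (M.run d (w.take N)) u)
    · obtain ⟨δ', hδ'⟩ := hasDist_of_special hd
      rcases lt_trichotomy δ δ' with h1 | h1 | h1
      · exact (h.farTail_of_lt hN hδ fun u hu => h1.trans_le (hδ'.2 u hu)).imp_right Or.inl
      · exact absurd ⟨δ, hδ, h1 ▸ hδ'⟩ hne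
      · exact (h.symm.farTail_of_lt hN hδ' fun u hu => h1.trans_le (hδ.2 u hu)).imp_right Or.inr
    · exact (h.farTail_of_lt hN hδ fun u hu => absurd ⟨u, hu⟩ hd).imp_right Or.inl
  · by_cases hd : ∃ u, M.Special (M.run (M.run d (w.take N)) u)
    · obtain ⟨δ', hδ'⟩ := hasDist_of_special hd
      exact (h.symm.farTail_of_lt hN hδ' fun u hu => absurd ⟨u, hu⟩ hc).imp_right Or.inr
    · exact Or.inl (h.length_of_far hN (j := w.length) (fun u hu => absurd ⟨u, hu⟩ hc)
        (fun u hu => absurd ⟨u, hu⟩ hd) (by omega))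

/-- The part of a minimal witness where the two runs are at equal distances is short if the
counter of one run is bounded there. -/
theorem MinimalWitness.le_of_counter_le {c d : Config S F} {w : List α}
    (h : M.MinimalWitness c d w) {N H : ℕ} (hNw : N ≤ w.length + 1)
    (hN : ∀ i < N, M.SameDist (M.run c (w.take i)) (M.run d (w.take i)))
    (hH : ∀ i < N, (M.run c (w.take i)).counter ≤ H) :
    N ≤ 2 * (Fintype.card S ^ 6 * (H + 1) * (44 * Fintype.card S ^ 5 + 1)) := by
  set K := Fintype.card S with hK
  have hb : ∀ i, ∃ X Y : ℕ, i < N → 1 ≤ X ∧ X ≤ K ^ 2 ∧ 1 ≤ Y ∧ Y ≤ K ^ 2 ∧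
      |(X : ℤ) * (M.run c (w.take i)).counter - Y * (M.run d (w.take i)).counter| ≤
        22 * (K : ℤ) ^ 5 := by
    intro i
    by_cases hi : i < N
    · obtain ⟨δ, h1, h2⟩ := hN i hi
      obtain ⟨X, Y, hXY⟩ := exists_belt h1 h2
      exact ⟨X, Y, fun _ => hXY⟩
    · exact ⟨0, 0, fun hi' => absurd hi' hi⟩
  choose X Y hXY using hb
  by_contra! hcon
  obtain ⟨i, j, k, -, hij, hjk, hkN, t1, t2⟩ := exists_three_eq (a := 0) (b := N)
    ((((Finset.univ : Finset (S × S)) ×ˢ Finset.range (H + 1)) ×ˢ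
      (Finset.Icc 1 (K ^ 2) ×ˢ Finset.Icc 1 (K ^ 2))) ×ˢ
      Finset.Icc (-(22 * (K : ℤ) ^ 5)) (22 * (K : ℤ) ^ 5))
    (fun i => (((((M.run c (w.take i)).state, (M.run d (w.take i)).state),
      (M.run c (w.take i)).counter), (X i, Y i)),
      (X i : ℤ) * (M.run c (w.take i)).counter - Y i * (M.run d (w.take i)).counter))
    (fun i _ hi => by
      obtain ⟨h1, h2, h3, h4, h5⟩ := hXY i hi
      have := hH i hi
      simp only [Finset.mem_product, Finset.mem_univ, true_and, Finset.mem_Icc, ← abs_le,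
        Finset.mem_range]
      exact ⟨⟨by omega, ⟨h1, h2⟩, h3, h4⟩, h5⟩)
    (by
      simp only [Finset.card_product, Finset.card_univ, Fintype.card_prod, Finset.card_range,
        Nat.card_Icc, Int.card_Icc, Nat.add_sub_cancel]
      have e : (22 * (K : ℤ) ^ 5 + 1 - -(22 * (K : ℤ) ^ 5)).toNat = 44 * K ^ 5 + 1 := by
        zify
        rw [Int.toNat_of_nonneg (by have : (0 : ℤ) ≤ (K : ℤ) ^ 5 := by positivity
                                    linarith)]
        ring
      rw [e, zero_add]
      calc _ = 2 * (K ^ 6 * (H + 1) * (44 * K ^ 5 + 1)) := by rw [hK]; ring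
        _ < N := hcon)
  simp only [Prod.mk.injEq] at t1 t2
  -- The second counter need not be recorded: belt, offset and first counter determine it.
  have key : ∀ i j, i < N → j < N → (M.run c (w.take i)).counter = (M.run c (w.take j)).counter →
      X i = X j → Y i = Y j →
      (X i : ℤ) * (M.run c (w.take i)).counter - Y i * (M.run d (w.take i)).counter =
      (X j : ℤ) * (M.run c (w.take j)).counter - Y j * (M.run d (w.take j)).counter →
      (M.run d (w.take i)).counter = (M.run d (w.take j)).counter := by
    intro i j hi hj h1 h2 h3 h4
    rw [h1, h2, h3, sub_right_inj] at h4
    have h5 : Y j ≠ 0 := by have := (hXY j hj).2.2.1; omega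
    exact_mod_cast mul_left_cancel₀ (by exact_mod_cast h5) h4
  have n1 := key i j (by omega) (by omega) t1.1.1.2 t1.1.2.1 t1.1.2.2 t1.2
  have n2 := key j k (by omega) (by omega) t2.1.1.2 t2.1.2.1 t2.1.2.2 t2.2
  refine h.no_loop ![i, j, k] hij hjk (by change k ≤ _; omega) (fun z => ?_) (fun z => ?_)
  · fin_cases z
    · exact ⟨rfl, rfl⟩
    · exact ⟨t1.1.1.1.1.symm, t1.1.1.2.symm⟩
    · exact ⟨(t1.1.1.1.1.trans t2.1.1.1.1).symm, (t1.1.1.2.trans t2.1.1.2).symm⟩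
  · fin_cases z
    · exact ⟨rfl, rfl⟩
    · exact ⟨t1.1.1.1.2.symm, n1.symm⟩
    · exact ⟨(t1.1.1.1.2.trans t2.1.1.1.2).symm, (n1.trans n2).symm⟩

theorem MinimalWitness.length_le {c d : Config S F} {w : List α} (h : M.MinimalWitness c d w)
    (hc : c.counter = 0) (hd : d.counter = 0) :
    w.length ≤ 500000 * Fintype.card S ^ 26 := by
  obtain ⟨N, hNw, hN, htail⟩ : ∃ N ≤ w.length + 1,
      (∀ i < N, M.SameDist (M.run c (w.take i)) (M.run d (w.take i))) ∧
      (w.length ≤ N + depth S ∨ M.FarTail c d w N ∨ M.FarTail d c w N) := by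
    classical
    by_cases hex : ∃ i, i ≤ w.length ∧ ¬ M.SameDist (M.run c (w.take i)) (M.run d (w.take i))
    · obtain ⟨h1, h2⟩ := Nat.find_spec hex
      refine ⟨Nat.find hex, by omega, fun i hi => ?_, h.tail h1 h2⟩
      by_contra hcon
      exact Nat.find_min hex hi ⟨by omega, hcon⟩
    · push Not at hex
      -- If the distances never differ, `N` lies one past the end of `w`, so that the whole run
      -- counts.
      exact ⟨w.length + 1, le_rfl, fun i hi => hex i (by omega), Or.inl (by omega)⟩
  have hheight := fun i hi => h.counter_le hc hNw hN htail (i := i) hi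
  have hcount := h.le_of_counter_le hNw hN hheight
  have hKpos : 0 < Fintype.card S := Fintype.card_pos_iff.2 ⟨c.state⟩
  have hdep : depth S = 2 * Fintype.card S ^ 2 := rfl
  have hdist : ∀ {c : Config S F} {δ}, M.HasDist c δ →
      δ ≤ Fintype.card S * c.counter + 4 * Fintype.card S ^ 3 := fun h => h.le
  have hbelt : ∀ i < N, ∃ X Y : ℕ, X ≤ Fintype.card S ^ 2 ∧ 1 ≤ Y ∧
      (Y : ℤ) * (M.run d (w.take i)).counter ≤ X * (M.run c (w.take i)).counter +
        22 * (Fintype.card S : ℤ) ^ 5 := by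
    intro i hi
    obtain ⟨δ, h1, h2⟩ := hN i hi
    obtain ⟨X, Y, -, h3, h4, -, h5⟩ := exists_belt h1 h2
    have := (abs_le.1 h5).1
    exact ⟨X, Y, h3, h4, by linarith⟩
  set K := Fintype.card S with hK
  have kp : ∀ {m : ℕ}, m ≤ 26 → K ^ m ≤ K ^ 26 := fun hm => Nat.pow_le_pow_right hKpos hm
  have kq : ∀ {m : ℕ}, m ≤ 16 → K ^ m ≤ K ^ 16 := fun hm => Nat.pow_le_pow_right hKpos hm
  -- The belt carries the bound for the first counter over to the second at the cost of a factor
  -- `K²`.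
  have hd' : ∀ i < N, (M.run d (w.take i)).counter ≤ 4422 * K ^ 16 := by
    intro i hi
    obtain ⟨X, Y, h1, h2, h3⟩ := hbelt i hi
    have h4 : Y * (M.run d (w.take i)).counter ≤ X * (M.run c (w.take i)).counter + 22 * K ^ 5 := by
      exact_mod_cast h3
    calc (M.run d (w.take i)).counter ≤ Y * (M.run d (w.take i)).counter :=
          Nat.le_mul_of_pos_left _ h2
      _ ≤ X * (M.run c (w.take i)).counter + 22 * K ^ 5 := h4
      _ ≤ K ^ 2 * (4400 * K ^ 14) + 22 * K ^ 16 :=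
          Nat.add_le_add (Nat.mul_le_mul h1 (hheight i hi)) (Nat.mul_le_mul le_rfl
            (kq (by norm_num)))
      _ = 4422 * K ^ 16 := by ring
  have hend : ∀ c : Config S F, c.counter = 0 →
      (∀ i < N, (M.run c (w.take i)).counter ≤ 4422 * K ^ 16) →
      (M.run c (w.take N)).counter ≤ 4423 * K ^ 16 := by
    intro c hc hcb
    have k0 : K ^ 0 ≤ K ^ 16 := kq (by norm_num)
    rw [pow_zero] at k0
    rcases Nat.eq_zero_or_pos N with h0 | h0
    · rw [h0, List.take_zero, run_nil, hc]
      omega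
    · have h1 := hcb (N - 1) (by omega)
      have h2 := (M.counter_take_succ c w (N - 1)).1
      rw [show N - 1 + 1 = N by omega] at h2
      omega
  have hNle : N ≤ 396090 * K ^ 26 := by
    calc N ≤ 2 * (K ^ 6 * (4400 * K ^ 14 + 1) * (44 * K ^ 5 + 1)) := hcount
      _ = 387200 * K ^ 25 + 8800 * K ^ 20 + 88 * K ^ 11 + 2 * K ^ 6 := by ring
      _ ≤ 387200 * K ^ 26 + 8800 * K ^ 26 + 88 * K ^ 26 + 2 * K ^ 26 := by
          gcongr <;> norm_num
      _ = 396090 * K ^ 26 := by ring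
  have k17 : K ^ 17 ≤ K ^ 26 := kp (by norm_num)
  have k3 : K ^ 3 ≤ K ^ 26 := kp (by norm_num)
  have k2 : K ^ 2 ≤ K ^ 26 := kp (by norm_num)
  have hfar : ∀ n δ, n ≤ 4423 * K ^ 16 → δ ≤ K * n + 4 * K ^ 3 → δ ≤ 4423 * K ^ 17 + 4 * K ^ 3 := by
    intro n δ h1 h2
    calc δ ≤ K * n + 4 * K ^ 3 := h2
      _ ≤ K * (4423 * K ^ 16) + 4 * K ^ 3 := by gcongr
      _ = _ := by ring
  rcases htail with ht | ⟨δ, h1, -, h2⟩ | ⟨δ, h1, -, h2⟩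
  · omega
  · have := hfar _ _ (hend c hc fun i hi => (hheight i hi).trans (by
      have : K ^ 14 ≤ K ^ 16 := kq (by norm_num)
      omega)) (hdist h1)
    omega
  · have := hfar _ _ (hend d hd hd') (hdist h1)
    omega

end Length

/-! ### Two automata as parts of one -/

section Merge

variable {S P Q α F : Type*}

/-- The automaton that has both `A` and `B` as parts. -/
def merge (A : DWROCA P α F) (B : DWROCA Q α F) : DWROCA (P ⊕ Q) α F where
  -- Any initial data would do, since runs are started from explicit configurations.
  init := Sum.inl A.init
  initWeight := A.initWeight
  δ₀ := Sum.elim (fun p a => (Sum.inl (A.δ₀ p a).1, (A.δ₀ p a).2))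
    (fun q a => (Sum.inr (B.δ₀ q a).1, (B.δ₀ q a).2))
  δ₁ := Sum.elim (fun p a => (Sum.inl (A.δ₁ p a).1, (A.δ₁ p a).2))
    (fun q a => (Sum.inr (B.δ₁ q a).1, (B.δ₁ q a).2))
  final := Sum.elim A.final B.final
  δ₀_change := by
    rintro (p | q) a
    · exact A.δ₀_change p a
    · exact B.δ₀_change q a
  δ₁_change := by
    rintro (p | q) a
    · exact A.δ₁_change p a
    · exact B.δ₁_change q a

/-- Runs are preserved by embeddings of automata. -/
theorem run_map [Field F] {A : DWROCA P α F} {M : DWROCA S α F} {f : P → S}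
    (h₀ : ∀ p a, M.δ₀ (f p) a = (f (A.δ₀ p a).1, (A.δ₀ p a).2))
    (h₁ : ∀ p a, M.δ₁ (f p) a = (f (A.δ₁ p a).1, (A.δ₁ p a).2)) (c : Config P F) (w : List α) :
    M.run ⟨f c.state, c.counter, c.weight⟩ w =
      ⟨f (A.run c w).state, (A.run c w).counter, (A.run c w).weight⟩ := by
  induction w generalizing c with
  | nil => rfl
  | cons a w ih =>
    rw [run_cons, run_cons, ← ih]
    congr 1
    unfold step trans
    split_ifs
    · simp [h₀]
    · simp [h₁]

theorem behaviour_map [Field F] {A : DWROCA P α F} {M : DWROCA S α F} {f : P → S}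
    (h₀ : ∀ p a, M.δ₀ (f p) a = (f (A.δ₀ p a).1, (A.δ₀ p a).2))
    (h₁ : ∀ p a, M.δ₁ (f p) a = (f (A.δ₁ p a).1, (A.δ₁ p a).2))
    (hf : ∀ p, M.final (f p) = A.final p) (w : List α) :
    M.behaviour ⟨f A.init, 0, A.initWeight⟩ w = A.value w := by
  unfold behaviour value
  rw [show (⟨f A.init, 0, A.initWeight⟩ : Config S F) =
    ⟨f A.initConfig.state, A.initConfig.counter, A.initConfig.weight⟩ from rfl,
    run_map h₀ h₁, hf]

end Merge
end DWROCA

theorem mainTheorem2 :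
    ∃ C : ℕ, ∀ (F : Type u) [Field F] (α : Type v) [Finite α]
      (P : Type w₁) [Fintype P] (Q : Type w₂) [Fintype Q]
      (A : DWROCA P α F) (B : DWROCA Q α F),
      ¬ A.Equivalent B →
        ∃ w : List α, w.length ≤ C * (A.size + B.size) ^ 26 ∧ A.value w ≠ B.value w := by
  refine ⟨500000, fun F _ α _ P _ Q _ A B hAB => ?_⟩
  have hA := DWROCA.behaviour_map (A := A) (M := A.merge B) (f := Sum.inl)
    (fun _ _ => rfl) (fun _ _ => rfl) (fun _ => rfl)
  have hB := DWROCA.behaviour_map (A := B) (M := A.merge B) (f := Sum.inr)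
    (fun _ _ => rfl) (fun _ _ => rfl) (fun _ => rfl)
  unfold DWROCA.Equivalent at hAB
  push Not at hAB
  obtain ⟨w, hw, hmin⟩ := DWROCA.exists_minimal_length hAB
  have hwit : (A.merge B).MinimalWitness ⟨Sum.inl A.init, 0, A.initWeight⟩
      ⟨Sum.inr B.init, 0, B.initWeight⟩ w :=
    ⟨by rwa [hA, hB], fun v hv => hmin v (by rwa [hA, hB] at hv)⟩
  refine ⟨w, ?_, hw⟩
  have := hwit.length_le rfl rfl
  rwa [Fintype.card_sum] at this
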